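/- Let $\mathcal S\subset\mathbb Z$ be a finite set whose only negative element is $-1$ (and which contains $-1$), and assume that $\mathcal S$ contains at least one element $\ge 1$ (i.e. $\mathcal S\ne\{-1\},\{-1,0\}$). Put $S(u)=\sum_{s\in\mathcal S}u^s$, and let $p$ be the period of $\mathcal S$, i.e. the largest integer for which there is a polynomial $Q$ with $uS(u)=Q(u^p)$; let $G(p)$ be the set of complex $p$-th roots of unity. Fix an integer $r\ge1$. A rooted plane tree with $n+1$ nodes and all outdegrees in $1+\mathcal S$ corresponds to the $\mathcal S$-excursion of length $n$ whose steps are $\deg(v)-1$, where $v$ runs over the first $n$ nodes in preorder. An $r$-ascent is an inclusion-wise maximal sequence of consecutive steps different from $-1$ that has exactly $r$ steps. Let $V(z,t)$ be the bivariate generating function of the rooted plane trees with all outdegrees in $1+\mathcal S$, where $z$ marks the number of nodes and $t$ marks the number of $r$-ascents of the corresponding excursion. Write $V(z)=V(z,1)$ and $V_t(z)=\frac{\partial}{\partial t}V(z,t)\big|_{t=1}$. 1. There is exactly one $\tau>0$ with $S'(\tau)=0$. The power series $V(z)$ has radius of convergence $\rho=1/S(\tau)$, and its singularities on $|z|=\rho$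 (the boundary points to which $V$ has no analytic continuation) are exactly the points $\zeta\rho$ with $\zeta\in G(p)$. All of them are square-root singularities: for $z$ near $\zeta\rho$, $|z|<\rho$, one has $V(z)=h\bigl((1-\frac z{\zeta\rho})^{1/2}\bigr)$ with some $h$ analytic at $0$, $h'(0)\neq0$. For each $\zeta\in G(p)$, $V$ continues analytically to a neighbourhood of $\zeta\rho$ slit along the ray $\{x\zeta\rho: x\ge1\}$, and there, as $z\to\zeta\rho$, $$V(z)=\zeta\tau-\zeta\sqrt{\frac{2S(\tau)}{S''(\tau)}}\Bigl(1-\frac z{\zeta\rho}\Bigr)^{1/2}-\zeta\,\frac{S(\tau)S'''(\tau)}{3S''(\tau)^2}\Bigl(1-\frac z{\zeta\rho}\Bigr)+O\Bigl(\Bigl(1-\frac z{\zeta\rho}\Bigr)^{3/2}\Bigr).$$ 2. For every $|z|<\rho$ the series $V(z,t)$ converges for all $t$ in a neighbourhood of $1$ and is analytic in $t$ at $t=1$. For every $\nu\ge0$ the derivative $\frac{\partial^\nu}{\partial t^\nu}V(z,t)\big|_{t=1}$ can be expressed in terms of $z$ and $V(z)$: there are polynomials $P_\nu,Q_\nu\in\mathbb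 Z[x,y]$ (depending on $\mathcal S$, $r$, $\nu$) such that, for all $|z|<\rho$, $Q_\nu(z,V(z))\ne0$ and $\frac{\partial^\nu}{\partial t^\nu}V(z,t)\big|_{t=1}=P_\nu(z,V(z))/Q_\nu(z,V(z))$. For the first derivative and $0<|z|<\rho$, one has $V(z)\ne0$, $S'(V(z))\neq0$ and $$V_t(z)=-z\,\frac{(V(z)-z)^r}{V(z)^{r+2}\,S'(V(z))}.$$ -/

import Mathlib

open Topology Asymptotics

noncomputable section

namespace Lukasiewicz

/-! ### Step sets -/

/-- A finite set of integers whose single negative element is `-1`. -/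
def IsStepSet (S : Finset ℤ) : Prop :=
  -1 ∈ S ∧ ∀ s ∈ S, s = -1 ∨ 0 ≤ s

/-- The characteristic (Laurent) polynomial `S(u) = ∑_{s ∈ S} u ^ s`, as a function on a field. -/
def stepGF {K : Type*} [Field K] (S : Finset ℤ) (u : K) : K :=
  ∑ s ∈ S, u ^ s

/-- `p` is the period of `S`: the largest integer such that `u S(u) = Q(u ^ p)` for some
polynomial `Q`. -/
def IsPeriod (S : Finset ℤ) (p : ℕ) : Prop :=
  IsGreatest {q : ℕ | ∃ Q : Polynomial ℂ, ∀ u : ℂ, u ≠ 0 → u * stepGF S u = Q.eval (u ^ q)} p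

/-! ### Plane trees and Łukasiewicz excursions -/

/-- Rooted plane trees: a root with an ordered list of `d` subtrees. -/
inductive PlaneTree : Type
  | node (d : ℕ) (children : Fin d → PlaneTree) : PlaneTree

namespace PlaneTree

/-- The number of nodes. -/
def size : PlaneTree → ℕ
  | node _ c => 1 + ∑ i, (c i).size

/-- All outdegrees lie in `1 + S`. -/
def DegreesIn (S : Finset ℤ) : PlaneTree → Prop
  | node d c => (d : ℤ) - 1 ∈ S ∧ ∀ i, (c i).DegreesIn S

/-- The sequence of the values `outdegree - 1`, listed in preorder. -/
def preorderSteps : PlaneTree → List ℤ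
  | node d c => ((d : ℤ) - 1) :: (List.ofFn fun i => (c i).preorderSteps).flatten

/-- The excursion that corresponds to a plane tree with `n + 1` nodes: the first `n` steps of
`preorderSteps` (the last node in preorder is a leaf and contributes a final down step). -/
def excursion (T : PlaneTree) : List ℤ :=
  T.preorderSteps.dropLast

theorem size_pos (T : PlaneTree) : 0 < T.size := by
  cases T; simp only [size]; omega

theorem finite_size_le (n : ℕ) : {T : PlaneTree | T.size ≤ n}.Finite := by
  induction n with
  | zero =>
    refine Set.finite_empty.subset fun T hT => ?_
    have := T.size_pos
    simp only [Set.mem_ofPred_eq] at hT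
    omega
  | succ n ih =>
    have h : (⋃ d ∈ Finset.range (n + 1), (fun c : Fin d → PlaneTree => node d c) ''
        Set.pi Set.univ fun _ => {T : PlaneTree | T.size ≤ n}).Finite :=
      Set.Finite.biUnion (Finset.finite_toSet _) fun d _ => (Set.Finite.pi' fun _ => ih).image _
        |>.subset (Set.image_mono fun c hc i => hc i trivial)
    refine h.subset ?_
    rintro ⟨d, c⟩ hT
    simp only [Set.mem_ofPred_eq, size] at hT
    have hd : d ≤ ∑ i, (c i).size := by
      calc d = ∑ _i : Fin d, 1 := by simp
        _ ≤ _ := Finset.sum_le_sum fun i _ => (c i).size_pos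
    refine Set.mem_biUnion (x := d) (by simp; omega) ⟨c, fun i _ => ?_, rfl⟩
    have := Finset.single_le_sum (f := fun i => (c i).size) (fun i _ => Nat.zero_le _)
      (Finset.mem_univ i)
    simp only [Set.mem_ofPred_eq]
    omega

end PlaneTree

/-- The plane trees with `n` nodes and all outdegrees in `1 + S`. -/
def trees (S : Finset ℤ) (n : ℕ) : Finset PlaneTree :=
  ((PlaneTree.finite_size_le n).subset
    (fun T (hT : T.size = n ∧ T.DegreesIn S) => hT.1.le)).toFinset

/-- The number of `r`-ascents (`r ≥ 1`) of a sequence of steps. Cutting the sequence at its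
down steps leaves the maximal blocks of consecutive up steps (and some empty blocks); the
`r`-ascents are the blocks with exactly `r` steps. -/
def ascents (r : ℕ) (l : List ℤ) : ℕ :=
  ((l.splitOn (-1)).map List.length).count r

/-- The polynomial in `t` that is the coefficient of `z ^ n` in `V(z, t)`: trees with `n` nodes,
where `t` marks the `r`-ascents of the corresponding excursion. -/
def treeCoeff (S : Finset ℤ) (r n : ℕ) (t : ℂ) : ℂ :=
  ∑ T ∈ trees S n, t ^ ascents r T.excursion

/-- The bivariate generating function `V(z, t)` (on its domain of convergence). -/
def V (S : Finset ℤ) (r : ℕ) (z t : ℂ) : ℂ :=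
  ∑' n : ℕ, treeCoeff S r n t * z ^ n

/-! ### Singularities on the circle of convergence -/

/-- `w` is a singularity of `f` (a function on the disc `‖z‖ < ρ`): `f` has no analytic
continuation to a neighbourhood of the boundary point `w`. -/
def IsSingularity (f : ℂ → ℂ) (ρ : ℝ) (w : ℂ) : Prop :=
  ¬ ∃ g : ℂ → ℂ, AnalyticAt ℂ g w ∧ ∀ᶠ z in 𝓝[Metric.ball 0 ρ] w, g z = f z

/-- `f` (a function on the disc `‖z‖ < ρ`) has a square-root singularity at the boundary point
`w`: near `w` it is a locally biholomorphic function of `(1 - z / w) ^ (1 / 2)`. -/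
def IsSqrtSingularity (f : ℂ → ℂ) (ρ : ℝ) (w : ℂ) : Prop :=
  ∃ h : ℂ → ℂ, AnalyticAt ℂ h 0 ∧ deriv h 0 ≠ 0 ∧
    ∀ᶠ z in 𝓝[Metric.ball 0 ρ] w, f z = h ((1 - z / w) ^ (1 / 2 : ℂ))

/-- The disc of radius `ε` around `w ≠ 0`, slit along the ray from `w` in direction `w`. -/
def slitBall (w : ℂ) (ε : ℝ) : Set ℂ :=
  {z | z ∈ Metric.ball w ε ∧ 1 - z / w ∈ Complex.slitPlane}

/-- The singular expansion `f(z) = e(z) + O(b(z))` as `z → w`: `f` (a function on the disc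
`‖z‖ < ρ`) continues analytically to a slit neighbourhood of `w`, where the continuation
satisfies the estimate. -/
def HasSingularExpansion (f : ℂ → ℂ) (ρ : ℝ) (w : ℂ) (e b : ℂ → ℂ) : Prop :=
  ∃ ε > 0, ∃ g : ℂ → ℂ, AnalyticOnNhd ℂ g (slitBall w ε) ∧
    (∀ z ∈ slitBall w ε ∩ Metric.ball 0 ρ, g z = f z) ∧
    (fun z => g z - e z) =O[𝓝[slitBall w ε] w] b

end Lukasiewicz

end

/-!
The number of nodes and the ascents of a plane tree can be read off at its leftmost branch: the
inner nodes on that branch form the initial ascent, and every other ascent belongs to exactly one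
of the subtrees attached to the branch (`PlaneTree.ascents_excursion`). With
`S(u) = 1 / u + U(u)`, `U = upPoly S`, this gives the functional equation
`V = z / (1 - z U(V)) + (t - 1) z (z U(V)) ^ r`, proved for sums over trees in
`IsMajorant.functional_equation`. At `t = 1` it reads `V = z φ(V)` with
`φ(u) = u S(u) = 1 + u U(u)`, that is, `z S(V) = 1`.

Let `S'(τ) = 0` and `ρ = 1 / S(τ)`. Then `ρ φ(τ) = τ` and `ρ φ'(τ) = 1`. The first equation bounds
all partial sums of `V(ρ, 1)` by `τ` (`PlaneTree.sum_size_le`), so the sum over trees converges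
normally for `|z| ≤ ρ`, `|z t| ≤ ρ`, with `|V| ≤ τ` at `t = 1`. The second one gives
`|z φ'(V)| < 1` for `|z| < ρ`, so that the `v`-derivative of the functional equation does not vanish
at `t = 1`; implicit differentiation expresses all `t`-derivatives rationally in `z` and `V`
(`IsCritical.exists_iteratedDeriv_eq`).

On the circle `|z| = ρ`, the inverse function theorem for `1 / S` continues `V` to every point with
`S'(V(z)) ≠ 0`. The other points are `ζ ρ` with `ζ ^ p = 1`, by the case of equality in the triangle
inequality (`IsCritical.exists_eq_mul_of_deriv_eq_zero`). As `V(ζ z) = ζ V(z)`, it suffices to study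
`ρ`. There, `1 - z / ρ = 1 - S(τ) / S(u)` has a double zero at `u = τ`, hence is `q(u) ^ 2` with `q`
locally invertible, and `V` is the inverse of `q` composed with `(1 - z / ρ) ^ (1 / 2)`
(`IsCritical.eventually_V_eq`, `IsCritical.exists_local_form`). The coefficients of the singular
expansion are the Taylor coefficients of this inverse (`isBigO_of_local_equation`).
-/

noncomputable section

namespace Lukasiewicz

/-! ### Ascents along the leftmost branch of a tree -/

/-- The number of blocks of length `r` in `l`, where the first block is counted as if it were
preceded by `k` further up steps. -/
def ascentsFrom (r k : ℕ) (l : List ℤ) : ℕ :=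
  (((l.splitOn (-1)).map List.length).modifyHead (k + ·)).count r

theorem ascentsFrom_zero (r : ℕ) (l : List ℤ) : ascentsFrom r 0 l = ascents r l := by
  unfold ascentsFrom ascents
  cases (l.splitOn (-1)).map List.length <;> simp

theorem ascentsFrom_nil (r k : ℕ) : ascentsFrom r k [] = if k = r then 1 else 0 := by
  simp [ascentsFrom, List.splitOn_nil, List.count_cons]

theorem ascentsFrom_down (r k : ℕ) (l : List ℤ) :
    ascentsFrom r k (-1 :: l) = (if k = r then 1 else 0) + ascents r l := by
  simp [ascentsFrom, ascents, List.splitOn_cons_eq_if_modifyHead, List.count_cons, add_comm]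

theorem ascentsFrom_up (r k : ℕ) {s : ℤ} (hs : s ≠ -1) (l : List ℤ) :
    ascentsFrom r k (s :: l) = ascentsFrom r (k + 1) l := by
  unfold ascentsFrom
  rw [List.splitOn_cons_eq_if_modifyHead]
  simp only [beq_iff_eq, hs, if_false]
  cases l.splitOn (-1) <;> simp [add_assoc, add_comm 1]

theorem ascentsFrom_append_down {r : ℕ} (hr : 1 ≤ r) (k : ℕ) (l : List ℤ) :
    ascentsFrom r k (l ++ [-1]) = ascentsFrom r k l := by
  have h0 : (0 : ℕ) ≠ r := by omega
  induction l generalizing k with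
  | nil => simp [ascentsFrom_down, ascentsFrom_nil, ascents, List.splitOn_nil, h0]
  | cons s l ih =>
    by_cases hs : s = -1
    · subst hs
      rw [List.cons_append, ascentsFrom_down, ascentsFrom_down, ← ascentsFrom_zero, ih,
        ascentsFrom_zero]
    · rw [List.cons_append, ascentsFrom_up r k hs, ascentsFrom_up r k hs, ih]

namespace PlaneTree

/-- The number of inner nodes on the leftmost branch. -/
def spine : PlaneTree → ℕ
  | node 0 _ => 0
  | node (_ + 1) c => (c 0).spine + 1

/-- The number of `r`-ascents other than the initial one, which runs along the leftmost branch: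
these are the ascents of the subtrees attached to the leftmost branch. -/
def offSpineAscents (r : ℕ) : PlaneTree → ℕ
  | node 0 _ => 0
  | node (_ + 1) c => (c 0).offSpineAscents r +
      ∑ i, ((c (Fin.succ i)).offSpineAscents r + if (c (Fin.succ i)).spine = r then 1 else 0)

theorem exists_preorderSteps_eq (T : PlaneTree) : ∃ l, T.preorderSteps = l ++ [-1] := by
  induction T with
  | node d c ih =>
    rcases d with _ | d
    · exact ⟨[], by simp [preorderSteps]⟩
    · choose l hl using ih
      rw [preorderSteps, List.ofFn_succ', List.concat_eq_append, List.flatten_append,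
        hl (Fin.last d)]
      simp only [List.flatten_cons, List.flatten_nil, List.append_nil, ← List.append_assoc,
        ← List.cons_append]
      exact ⟨_, rfl⟩

/-- Reading the preorder steps of `T` after `k` up steps: the leftmost branch prolongs the current
ascent, and its leaf ends it. -/
theorem ascentsFrom_preorderSteps_append (r : ℕ) (T : PlaneTree) (k : ℕ) (l : List ℤ) :
    ascentsFrom r k (T.preorderSteps ++ l) =
      T.offSpineAscents r + (if k + T.spine = r then 1 else 0) + ascents r l := by
  induction T generalizing k l with
  | node d c ih =>
    rcases d with _ | d
    · simp [preorderSteps, offSpineAscents, spine, ascentsFrom_down]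
    · have hd : ((d + 1 : ℕ) : ℤ) - 1 ≠ -1 := by push_cast; omega
      have tail : ∀ (m : ℕ) (c' : Fin m → PlaneTree)
          (_ : ∀ i l, ascents r ((c' i).preorderSteps ++ l) = (c' i).offSpineAscents r +
            (if (c' i).spine = r then 1 else 0) + ascents r l),
          ascents r ((List.ofFn fun i => (c' i).preorderSteps).flatten ++ l) =
            ∑ i, ((c' i).offSpineAscents r + if (c' i).spine = r then 1 else 0) +
              ascents r l := by
        intro m
        induction m with
        | zero => intro c' _; simp
        | succ m ihm =>
          intro c' h
          rw [List.ofFn_succ, List.flatten_cons, List.append_assoc, h,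
            ihm (fun i => c' i.succ) (fun i => h i.succ), Fin.sum_univ_succ]
          omega
      rw [preorderSteps, List.cons_append, ascentsFrom_up r k hd, List.ofFn_succ,
        List.flatten_cons, List.append_assoc, ih, tail d (fun i => c i.succ)]
      · have hk : k + 1 + (c 0).spine = k + ((c 0).spine + 1) := by omega
        rw [hk, offSpineAscents, spine]
        omega
      · intro i l
        rw [← ascentsFrom_zero, ih, zero_add]

theorem ascents_excursion {r : ℕ} (hr : 1 ≤ r) (T : PlaneTree) :
    ascents r T.excursion = T.offSpineAscents r + if T.spine = r then 1 else 0 := by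
  have h := ascentsFrom_preorderSteps_append r T 0 []
  obtain ⟨l, hl⟩ := T.exists_preorderSteps_eq
  have h0 : ascents r [] = 0 := by
    rw [← ascentsFrom_zero, ascentsFrom_nil, if_neg (by omega)]
  rw [List.append_nil, hl, ascentsFrom_append_down hr, zero_add, h0, add_zero,
    ascentsFrom_zero] at h
  rw [excursion, hl, List.dropLast_concat, h]

theorem ascents_excursion_le_size {r : ℕ} (hr : 1 ≤ r) (T : PlaneTree) :
    ascents r T.excursion ≤ T.size := by
  rw [ascents_excursion hr]
  induction T with
  | node d c ih =>
    rcases d with _ | d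
    · rw [offSpineAscents, size, spine]
      split_ifs <;> omega
    · have h0 := ih 0
      have hs := Finset.sum_le_sum fun (i : Fin d) (_ : i ∈ Finset.univ) => ih i.succ
      have : (c 0).offSpineAscents r ≤ (c 0).size := by omega
      simp only [offSpineAscents, size, Fin.sum_univ_succ (n := d)]
      split_ifs <;> omega

end PlaneTree

/-! ### The up steps as a polynomial -/

/-- The nonnegative elements of `S`, as natural numbers. -/
def upSteps (S : Finset ℤ) : Finset ℕ :=
  S.preimage (Nat.cast : ℕ → ℤ) Nat.cast_injective.injOn

theorem mem_upSteps {S : Finset ℤ} {d : ℕ} : d ∈ upSteps S ↔ (d : ℤ) ∈ S := by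
  simp [upSteps]

/-- The nonnegative part of `S(u)`, so that `S(u) = u⁻¹ + upPoly S (u)`. -/
def upPoly (S : Finset ℤ) : Polynomial ℤ :=
  ∑ d ∈ upSteps S, Polynomial.X ^ d

theorem aeval_upPoly {K : Type*} [CommRing K] (S : Finset ℤ) (u : K) :
    Polynomial.aeval u (upPoly S) = ∑ d ∈ upSteps S, u ^ d := by
  simp [upPoly]

theorem stepGF_eq {K : Type*} [Field K] {S : Finset ℤ} (hS : IsStepSet S) (u : K) :
    stepGF S u = u⁻¹ + Polynomial.aeval u (upPoly S) := by
  have h : S = insert (-1) ((upSteps S).map Nat.castEmbedding) := by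
    ext s
    simp only [Finset.mem_insert, Finset.mem_map, mem_upSteps, Nat.castEmbedding_apply]
    constructor
    · intro hs
      refine (hS.2 s hs).imp_right fun h0 => ⟨s.toNat, ?_, ?_⟩ <;> simp [h0, hs]
    · rintro (rfl | ⟨d, hd, rfl⟩)
      exacts [hS.1, hd]
  have hm : (-1 : ℤ) ∉ (upSteps S).map Nat.castEmbedding := by
    simp only [Finset.mem_map, Nat.castEmbedding_apply, not_exists, not_and]
    intro d _; omega
  unfold stepGF
  conv_lhs => rw [h]
  rw [Finset.sum_insert hm, aeval_upPoly]
  simp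

theorem norm_aeval_upPoly_le (S : Finset ℤ) (u : ℂ) {x : ℝ} (hu : ‖u‖ ≤ x) :
    ‖Polynomial.aeval u (upPoly S)‖ ≤ Polynomial.aeval x (upPoly S) := by
  rw [aeval_upPoly, aeval_upPoly]
  refine (norm_sum_le _ _).trans (Finset.sum_le_sum fun d _ => ?_)
  rw [norm_pow]
  gcongr

/-! ### Sums over plane trees -/

/-- The sum of a product function over tuples is the power of the sum. -/
theorem summable_and_tsum_prod {α : Type*} {f : α → ℂ} (hf : Summable fun a => ‖f a‖) (d : ℕ) :
    (Summable fun c : Fin d → α => ‖∏ i, f (c i)‖) ∧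
      ∑' c : Fin d → α, ∏ i, f (c i) = (∑' a, f a) ^ d := by
  induction d with
  | zero => exact ⟨(hasSum_fintype _).summable, by simp⟩
  | succ d ih =>
    have key : ∀ x : α × (Fin d → α),
        ∏ i, f ((Fin.consEquiv (fun _ : Fin (d + 1) => α)) x i) = f x.1 * ∏ i, f (x.2 i) := by
      intro x; simp [Fin.prod_univ_succ, Fin.consEquiv]
    constructor
    · rw [← (Fin.consEquiv (fun _ : Fin (d + 1) => α)).summable_iff]
      simp only [Function.comp_def, key]
      exact Summable.mul_norm (f := f) (g := fun c : Fin d → α => ∏ i, f (c i)) hf ih.1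
    · rw [← (Fin.consEquiv (fun _ : Fin (d + 1) => α)).tsum_eq]
      simp only [key]
      rw [pow_succ', ← ih.2, ← tsum_mul_tsum_of_summable_norm (f := f)
        (g := fun c : Fin d → α => ∏ i, f (c i)) hf ih.1]

namespace PlaneTree

/-- A tree is the tuple of its subtrees. -/
def equivSigma : PlaneTree ≃ Σ d, (Fin d → PlaneTree) where
  toFun | node d c => ⟨d, c⟩
  invFun x := node x.1 x.2
  left_inv := by rintro ⟨d, c⟩; rfl
  right_inv := by rintro ⟨d, c⟩; rfl

open Classical in
/-- The weight `z ^ size * t ^ (number of r-ascents other than the initial one)` of the trees with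
all outdegrees in `1 + S`; the other trees have weight `0`. -/
def spineWeight (S : Finset ℤ) (r : ℕ) (z t : ℂ) (T : PlaneTree) : ℂ :=
  if T.DegreesIn S then z ^ T.size * t ^ T.offSpineAscents r else 0

/-- The weight `z ^ size * t ^ (number of r-ascents)` of the trees with all outdegrees in
`1 + S`; the other trees have weight `0`. -/
def weight (S : Finset ℤ) (r : ℕ) (z t : ℂ) (T : PlaneTree) : ℂ :=
  (if T.spine = r then t else 1) * T.spineWeight S r z t

open Classical in
theorem weight_eq {S : Finset ℤ} {r : ℕ} (hr : 1 ≤ r) (z t : ℂ) (T : PlaneTree) :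
    T.weight S r z t = if T.DegreesIn S then z ^ T.size * t ^ ascents r T.excursion else 0 := by
  rw [weight, spineWeight, ascents_excursion hr]
  split_ifs <;> simp [pow_succ]; ring

theorem spineWeight_zero {S : Finset ℤ} (hS : IsStepSet S) (r : ℕ) (z t : ℂ)
    (c : Fin 0 → PlaneTree) : (node 0 c).spineWeight S r z t = z := by
  simp [spineWeight, DegreesIn, hS.1, size, offSpineAscents]

theorem spineWeight_succ (S : Finset ℤ) (r : ℕ) (z t : ℂ) (d : ℕ)
    (c : Fin (d + 1) → PlaneTree) :
    (node (d + 1) c).spineWeight S r z t = (if d ∈ upSteps S then z else 0) *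
      ((c 0).spineWeight S r z t * ∏ i : Fin d, (c i.succ).weight S r z t) := by
  classical
  by_cases h : (node (d + 1) c).DegreesIn S
  · have h' := h
    rw [DegreesIn] at h'
    have hd : d ∈ upSteps S := by simpa [mem_upSteps] using h'.1
    have hp : ∀ i, spineWeight S r z t (c i) = z ^ (c i).size * t ^ (c i).offSpineAscents r :=
      fun i => if_pos (h'.2 i)
    rw [spineWeight, if_pos h, if_pos hd]
    simp only [weight, hp, size, offSpineAscents, Fin.sum_univ_succ (n := d), pow_add,
      Finset.prod_mul_distrib, pow_ite, pow_one, pow_zero,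
      ← Finset.prod_pow_eq_pow_sum]
    ring
  · rw [spineWeight, if_neg h]
    rw [DegreesIn, not_and_or, not_forall] at h
    rcases h with h | ⟨i, hi⟩
    · rw [if_neg, zero_mul]
      simpa [mem_upSteps] using h
    · refine Eq.symm (mul_eq_zero_of_right _ ?_)
      rcases Fin.eq_zero_or_eq_succ i with rfl | ⟨j, rfl⟩
      · rw [spineWeight, if_neg hi, zero_mul]
      · refine mul_eq_zero_of_right _ (Finset.prod_eq_zero (Finset.mem_univ j) ?_)
        rw [weight, spineWeight, if_neg hi, mul_zero]

/-- Decomposing trees at the root: the sum of `g (spine T)` times the weight satisfies a linear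
recursion in `g`. The first subtree inherits the leftmost branch, the other ones contribute all of
their ascents. -/
theorem tsum_spineWeight {S : Finset ℤ} (hS : IsStepSet S) {r : ℕ} {z t : ℂ}
    (h₁ : Summable fun T : PlaneTree => ‖T.spineWeight S r z t‖)
    (h₂ : Summable fun T : PlaneTree => ‖T.weight S r z t‖)
    (g : ℕ → ℂ) {C : ℝ} (hg : ∀ k, ‖g k‖ ≤ C) :
    ∑' T : PlaneTree, g T.spine * T.spineWeight S r z t =
      g 0 * z + z * Polynomial.aeval (∑' T : PlaneTree, T.weight S r z t) (upPoly S) *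
        ∑' T : PlaneTree, g (T.spine + 1) * T.spineWeight S r z t := by
  have bdd : ∀ g : ℕ → ℂ, (∀ k, ‖g k‖ ≤ C) →
      Summable fun T : PlaneTree => ‖g T.spine * T.spineWeight S r z t‖ := fun g hg =>
    (h₁.mul_left C).of_nonneg_of_le (fun _ => norm_nonneg _) fun T => by
      rw [norm_mul]; gcongr; exact hg _
  have hs := (bdd g hg).of_norm
  have hs' := bdd (fun k => g (k + 1)) (fun k => hg _)
  rw [← equivSigma.symm.tsum_eq]
  have hsig : Summable fun x => g (equivSigma.symm x).spine *
      (equivSigma.symm x).spineWeight S r z t := equivSigma.symm.summable_iff.mpr hs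
  have hd : ∀ d : ℕ, ∑' c : Fin (d + 1) → PlaneTree,
      g (node (d + 1) c).spine * (node (d + 1) c).spineWeight S r z t =
      (if d ∈ upSteps S then z else 0) * ((∑' T : PlaneTree, g (T.spine + 1) *
        T.spineWeight S r z t) * (∑' T : PlaneTree, T.weight S r z t) ^ d) := by
    intro d
    obtain ⟨hp, hp'⟩ := summable_and_tsum_prod h₂ d
    rw [← hp', tsum_mul_tsum_of_summable_norm hs' hp, ← tsum_mul_left,
      ← (Fin.consEquiv (fun _ : Fin (d + 1) => PlaneTree)).tsum_eq]
    refine tsum_congr fun x => ?_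
    simp only [Fin.consEquiv, Equiv.coe_fn_mk, spineWeight_succ, spine, Fin.cons_zero,
      Fin.cons_succ]
    ring
  have h0 : ∑' c : Fin 0 → PlaneTree, g (node 0 c).spine * (node 0 c).spineWeight S r z t =
      g 0 * z := by
    simp only [spineWeight_zero hS, spine]
    simp
  rw [Summable.tsum_sigma hsig]
  simp only [equivSigma, Equiv.coe_fn_symm_mk]
  have hsum : Summable fun d : ℕ => ∑' c : Fin d → PlaneTree,
      g (node d c).spine * (node d c).spineWeight S r z t := hsig.sigma
  rw [hsum.tsum_eq_zero_add, h0]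
  simp only [hd]
  rw [tsum_eq_sum (s := upSteps S) (fun d hd' => by rw [if_neg hd', zero_mul]), aeval_upPoly,
    Finset.mul_sum, Finset.sum_mul]
  congr 1
  refine Finset.sum_congr rfl fun d hd' => ?_
  rw [if_pos hd']; ring

open Classical in
/-- If `x φ(y) ≤ y`, where `φ(y) = 1 + y * upPoly S (y)`, then by induction on the size the
generating function of trees at `x` has partial sums at most `y`. -/
theorem sum_size_le {S : Finset ℤ} {x y : ℝ} (hx : 0 ≤ x) (hy : 0 ≤ y)
    (hxy : x * (1 + y * Polynomial.aeval y (upPoly S)) ≤ y) (F : Finset PlaneTree) :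
    ∑ T ∈ F, (if T.DegreesIn S then x ^ T.size else 0) ≤ y := by
  have key : ∀ n : ℕ, ∑ T ∈ (finite_size_le n).toFinset,
      (if T.DegreesIn S then x ^ T.size else 0) ≤ y := by
    intro n
    induction n with
    | zero =>
      rw [Finset.sum_eq_zero]
      · exact hy
      · intro T hT
        have := T.size_pos
        simp only [Set.Finite.mem_toFinset, Set.mem_ofPred_eq] at hT
        omega
    | succ n ih =>
      set B := (finite_size_le n).toFinset with hB
      set A := ∑ T ∈ B, (if T.DegreesIn S then x ^ T.size else 0) with hA
      have hA0 : 0 ≤ A := Finset.sum_nonneg fun T _ => by split_ifs <;> positivity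
      set D : Finset ℕ := insert 0 ((upSteps S).image (· + 1)) with hD
      have hterm : ∀ (d : ℕ) (c : Fin d → PlaneTree),
          (if (node d c).DegreesIn S then x ^ (node d c).size else 0) ≤
            x * ∏ i, (if (c i).DegreesIn S then x ^ (c i).size else 0) := by
        intro d c
        split_ifs with h
        · rw [DegreesIn] at h
          simp only [h.2, if_true, size, pow_add, pow_one, Finset.prod_pow_eq_pow_sum, le_refl]
        · exact mul_nonneg hx (Finset.prod_nonneg fun i _ => by split_ifs <;> positivity)
      calc ∑ T ∈ (finite_size_le (n + 1)).toFinset, (if T.DegreesIn S then x ^ T.size else 0)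
          ≤ ∑ T ∈ D.biUnion fun d => (Fintype.piFinset fun _ : Fin d => B).image (node d),
              (if T.DegreesIn S then x ^ T.size else 0) := by
            rw [← Finset.sum_filter_ne_zero]
            refine Finset.sum_le_sum_of_subset_of_nonneg (fun T hT => ?_) fun T _ _ => by
              split_ifs <;> positivity
            obtain ⟨hT, h⟩ := Finset.mem_filter.mp hT
            have hT' : T.DegreesIn S := by by_contra h'; exact h (if_neg h')
            rcases T with ⟨d, c⟩
            rw [DegreesIn] at hT'
            simp only [Set.Finite.mem_toFinset, Set.mem_ofPred_eq, size] at hT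
            simp only [Finset.mem_biUnion, Finset.mem_image, Fintype.mem_piFinset, hB,
              Set.Finite.mem_toFinset, Set.mem_ofPred_eq]
            refine ⟨d, ?_, c, fun i => ?_, rfl⟩
            · rcases d with _ | d
              · simp [hD]
              · refine Finset.mem_insert_of_mem (Finset.mem_image.mpr ⟨d, ?_, rfl⟩)
                simpa [mem_upSteps] using hT'.1
            · have := Finset.single_le_sum (f := fun i => (c i).size) (fun i _ => Nat.zero_le _)
                (Finset.mem_univ i)
              omega
        _ ≤ ∑ d ∈ D, ∑ T ∈ (Fintype.piFinset fun _ : Fin d => B).image (node d),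
              (if T.DegreesIn S then x ^ T.size else 0) := by
            refine (Finset.sum_biUnion ?_).le
            intro d _ e _ hde
            rw [Function.onFun, Finset.disjoint_left]
            intro T h1 h2
            simp only [Finset.mem_image] at h1 h2
            obtain ⟨c, _, rfl⟩ := h1
            obtain ⟨c', _, h⟩ := h2
            exact hde (node.inj h).1.symm
        _ ≤ ∑ d ∈ D, x * A ^ d := by
            refine Finset.sum_le_sum fun d _ => ?_
            rw [Finset.sum_image fun c _ c' _ h => eq_of_heq (node.inj h).2]
            refine (Finset.sum_le_sum fun c _ => hterm d c).trans (le_of_eq ?_)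
            rw [← Finset.mul_sum, Finset.sum_prod_piFinset B
              fun _ T => if T.DegreesIn S then x ^ T.size else 0]
            simp [hA]
        _ ≤ ∑ d ∈ D, x * y ^ d := by
            refine Finset.sum_le_sum fun d _ => ?_
            gcongr
        _ = x * (1 + y * Polynomial.aeval y (upPoly S)) := by
            rw [hD, Finset.sum_insert (by simp),
              Finset.sum_image (fun a _ b _ h => by simpa using h), aeval_upPoly,
              mul_add, Finset.mul_sum, Finset.mul_sum, pow_zero]
            exact congrArg _ (Finset.sum_congr rfl fun d _ => by rw [pow_succ'])
        _ ≤ y := hxy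
  refine le_trans (Finset.sum_le_sum_of_subset_of_nonneg (t := (finite_size_le
    (F.sup size)).toFinset) ?_ ?_) (key (F.sup size))
  · intro T hT
    simpa using Finset.le_sup (f := size) hT
  · intro T _ _
    split_ifs <;> positivity

end PlaneTree

/-! ### The generating function as a sum over trees -/

theorem pow_mul_pow_le {a b x : ℝ} (ha : 0 ≤ a) (hb : 0 ≤ b) (hax : a ≤ x) (habx : a * b ≤ x)
    {m n : ℕ} (hmn : m ≤ n) : a ^ n * b ^ m ≤ x ^ n := by
  rcases le_total b 1 with h | h
  · calc a ^ n * b ^ m ≤ a ^ n * 1 := by gcongr; exact pow_le_one₀ hb h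
      _ ≤ x ^ n := by rw [mul_one]; gcongr
  · calc a ^ n * b ^ m ≤ a ^ n * b ^ n := by gcongr
      _ = (a * b) ^ n := (mul_pow _ _ _).symm
      _ ≤ x ^ n := by gcongr

namespace PlaneTree

open Classical in
/-- The term `x ^ size` of a tree with all outdegrees in `1 + S`, and `0` for other trees. -/
def sizeWeight (S : Finset ℤ) (x : ℝ) (T : PlaneTree) : ℝ :=
  if T.DegreesIn S then x ^ T.size else 0

theorem sizeWeight_nonneg {S : Finset ℤ} {x : ℝ} (hx : 0 ≤ x) (T : PlaneTree) :
    0 ≤ T.sizeWeight S x := by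
  unfold sizeWeight; split_ifs <;> positivity

theorem summable_sizeWeight {S : Finset ℤ} {x y : ℝ} (hx : 0 ≤ x) (hy : 0 ≤ y)
    (hxy : x * (1 + y * Polynomial.aeval y (upPoly S)) ≤ y) :
    Summable fun T : PlaneTree => T.sizeWeight S x :=
  summable_of_sum_le (sizeWeight_nonneg hx) (sum_size_le hx hy hxy)

theorem tsum_sizeWeight_le {S : Finset ℤ} {x y : ℝ} (hx : 0 ≤ x) (hy : 0 ≤ y)
    (hxy : x * (1 + y * Polynomial.aeval y (upPoly S)) ≤ y) :
    ∑' T : PlaneTree, T.sizeWeight S x ≤ y :=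
  (summable_sizeWeight hx hy hxy).tsum_le_of_sum_le (sum_size_le hx hy hxy)

theorem norm_weight_le {S : Finset ℤ} {r : ℕ} (hr : 1 ≤ r) {x : ℝ} {z t : ℂ} (hz : ‖z‖ ≤ x)
    (hzt : ‖z‖ * ‖t‖ ≤ x) (T : PlaneTree) : ‖T.weight S r z t‖ ≤ T.sizeWeight S x := by
  rw [weight_eq hr, sizeWeight]
  split_ifs
  · rw [norm_mul, norm_pow, norm_pow]
    exact pow_mul_pow_le (norm_nonneg _) (norm_nonneg _) hz hzt (T.ascents_excursion_le_size hr)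
  · simp

theorem norm_spineWeight_le {S : Finset ℤ} {r : ℕ} (hr : 1 ≤ r) {x : ℝ} {z t : ℂ} (hz : ‖z‖ ≤ x)
    (hzt : ‖z‖ * ‖t‖ ≤ x) (T : PlaneTree) : ‖T.spineWeight S r z t‖ ≤ T.sizeWeight S x := by
  have := T.ascents_excursion_le_size hr
  rw [ascents_excursion hr] at this
  rw [spineWeight, sizeWeight]
  split_ifs
  · rw [norm_mul, norm_pow, norm_pow]
    exact pow_mul_pow_le (norm_nonneg _) (norm_nonneg _) hz hzt (by omega)
  · simp

end PlaneTree

/-- A pair `(ρ, τ)` such that the generating function `V` at radius `ρ` is majorized by `τ`: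
`ρ φ(τ) = τ`, where `φ(u) = 1 + u * upPoly S (u)`. -/
structure IsMajorant (S : Finset ℤ) (ρ τ : ℝ) : Prop where
  isStepSet : IsStepSet S
  rho_pos : 0 < ρ
  tau_pos : 0 < τ
  eq : ρ * (1 + τ * Polynomial.aeval τ (upPoly S)) = τ

namespace IsMajorant

open PlaneTree

variable {S : Finset ℤ} {ρ τ : ℝ} {r : ℕ}

theorem summable_bound (h : IsMajorant S ρ τ) : Summable fun T : PlaneTree => T.sizeWeight S ρ :=
  summable_sizeWeight h.rho_pos.le h.tau_pos.le h.eq.le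

theorem summable_weight (h : IsMajorant S ρ τ) (hr : 1 ≤ r) {z t : ℂ} (hz : ‖z‖ ≤ ρ)
    (hzt : ‖z‖ * ‖t‖ ≤ ρ) : Summable fun T : PlaneTree => ‖T.weight S r z t‖ :=
  h.summable_bound.of_nonneg_of_le (fun _ => norm_nonneg _) (norm_weight_le hr hz hzt)

theorem summable_spineWeight (h : IsMajorant S ρ τ) (hr : 1 ≤ r) {z t : ℂ} (hz : ‖z‖ ≤ ρ)
    (hzt : ‖z‖ * ‖t‖ ≤ ρ) : Summable fun T : PlaneTree => ‖T.spineWeight S r z t‖ :=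
  h.summable_bound.of_nonneg_of_le (fun _ => norm_nonneg _) (norm_spineWeight_le hr hz hzt)

theorem _root_.Lukasiewicz.mem_trees {n : ℕ} {T : PlaneTree} :
    T ∈ trees S n ↔ T.size = n ∧ T.DegreesIn S :=
  Set.Finite.mem_toFinset _

theorem hasSum_treeCoeff (h : IsMajorant S ρ τ) (hr : 1 ≤ r) {z t : ℂ} (hz : ‖z‖ ≤ ρ)
    (hzt : ‖z‖ * ‖t‖ ≤ ρ) :
    HasSum (fun n => treeCoeff S r n t * z ^ n) (∑' T : PlaneTree, T.weight S r z t) := by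
  classical
  suffices hn : ∀ n, treeCoeff S r n t * z ^ n =
      ∑' T : ↥(size ⁻¹' {n}), (T : PlaneTree).weight S r z t by
    simp only [hn]
    exact ((h.summable_weight hr hz hzt).of_norm.hasSum).tsum_fiberwise size
  intro n
  have hsub : ∑' T : ↥(size ⁻¹' {n}), (T : PlaneTree).weight S r z t =
      ∑' T : PlaneTree, (size ⁻¹' {n}).indicator (fun T => T.weight S r z t) T :=
    tsum_subtype _ _
  rw [hsub, tsum_eq_sum (s := trees S n), treeCoeff, Finset.sum_mul]
  · refine Finset.sum_congr rfl fun T hT => ?_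
    rw [mem_trees] at hT
    rw [Set.indicator_of_mem (by exact hT.1), weight_eq hr, if_pos hT.2, hT.1, mul_comm]
  · intro T hT
    rw [mem_trees, not_and] at hT
    by_cases hn : T.size = n
    · rw [Set.indicator_of_mem (by exact hn), weight_eq hr, if_neg (hT hn)]
    · rw [Set.indicator_of_notMem (by exact hn)]

theorem V_eq (h : IsMajorant S ρ τ) (hr : 1 ≤ r) {z t : ℂ} (hz : ‖z‖ ≤ ρ)
    (hzt : ‖z‖ * ‖t‖ ≤ ρ) : V S r z t = ∑' T : PlaneTree, T.weight S r z t :=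
  (h.hasSum_treeCoeff hr hz hzt).tsum_eq

theorem V_one_eq (h : IsMajorant S ρ τ) (hr : 1 ≤ r) {z : ℂ} (hz : ‖z‖ ≤ ρ) :
    V S r z 1 = ∑' T : PlaneTree, T.weight S r z 1 :=
  h.V_eq hr hz (by simpa using hz)

theorem norm_V_le (h : IsMajorant S ρ τ) (hr : 1 ≤ r) {z : ℂ} (hz : ‖z‖ ≤ ρ) :
    ‖V S r z 1‖ ≤ τ := by
  have hz' : ‖z‖ * ‖(1 : ℂ)‖ ≤ ρ := by simpa using hz
  rw [h.V_one_eq hr hz]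
  exact (tsum_of_norm_bounded h.summable_bound.hasSum (norm_weight_le hr hz hz')).trans
    (tsum_sizeWeight_le h.rho_pos.le h.tau_pos.le h.eq.le)

/-- The first subtrees along the leftmost branch are stripped off one after another: after `k`
steps down, the generating function is `z (z * upPoly S (V)) ^ k`. -/
theorem tsum_spine_eq (h : IsMajorant S ρ τ) (hr : 1 ≤ r) {z t : ℂ} (hz : ‖z‖ ≤ ρ)
    (hzt : ‖z‖ * ‖t‖ ≤ ρ) (k : ℕ) :
    ∑' T : PlaneTree, (if T.spine = k then 1 else 0) * T.spineWeight S r z t =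
      z * (z * Polynomial.aeval (V S r z t) (upPoly S)) ^ k := by
  have h₁ := h.summable_spineWeight hr hz hzt
  have h₂ := h.summable_weight hr hz hzt
  have hb : ∀ k n : ℕ, ‖(if n = k then 1 else 0 : ℂ)‖ ≤ 1 := by
    intro k n; split_ifs <;> simp
  rw [h.V_eq hr hz hzt]
  induction k with
  | zero => rw [tsum_spineWeight h.isStepSet h₁ h₂ (fun n => if n = 0 then 1 else 0) (hb 0)]; simp
  | succ k ih =>
    rw [tsum_spineWeight h.isStepSet h₁ h₂ (fun n => if n = k + 1 then 1 else 0) (hb (k + 1))]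
    simp only [Nat.add_right_cancel_iff, ih]
    simp only [Nat.zero_ne_add_one, if_false]
    ring

/-- The functional equation of `V(z, t)`, with its denominator cleared. -/
theorem functional_equation (h : IsMajorant S ρ τ) (hr : 1 ≤ r) {z t : ℂ} (hz : ‖z‖ ≤ ρ)
    (hzt : ‖z‖ * ‖t‖ ≤ ρ) :
    V S r z t * (1 - z * Polynomial.aeval (V S r z t) (upPoly S)) =
      z + (t - 1) * (z * (z * Polynomial.aeval (V S r z t) (upPoly S)) ^ r) *
        (1 - z * Polynomial.aeval (V S r z t) (upPoly S)) := by
  have h₁ := h.summable_spineWeight hr hz hzt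
  have h₂ := h.summable_weight hr hz hzt
  have hX := tsum_spineWeight h.isStepSet h₁ h₂ (fun _ => 1) (C := 1) (fun _ => by simp)
  simp only [one_mul] at hX
  rw [← h.V_eq hr hz hzt] at hX
  have hW := h.tsum_spine_eq hr hz hzt r
  have hsW : Summable fun T : PlaneTree =>
      (if T.spine = r then 1 else 0) * T.spineWeight S r z t := by
    refine Summable.of_norm (h₁.of_nonneg_of_le (fun _ => norm_nonneg _) fun T => ?_)
    split_ifs <;> simp
  have hV : V S r z t = ∑' T : PlaneTree, T.spineWeight S r z t + (t - 1) *
      (z * (z * Polynomial.aeval (V S r z t) (upPoly S)) ^ r) := by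
    rw [← hW, ← tsum_mul_left, ← h₁.of_norm.tsum_add (hsW.mul_left _)]
    conv_lhs => rw [h.V_eq hr hz hzt]
    refine tsum_congr fun T => ?_
    rw [weight]
    split_ifs <;> ring
  linear_combination (1 - z * Polynomial.aeval (V S r z t) (upPoly S)) * hV + hX

theorem functional_equation_one (h : IsMajorant S ρ τ) (hr : 1 ≤ r) {z : ℂ} (hz : ‖z‖ ≤ ρ) :
    V S r z 1 = z * (1 + V S r z 1 * Polynomial.aeval (V S r z 1) (upPoly S)) := by
  have := h.functional_equation hr (t := 1) hz (by simpa using hz)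
  linear_combination this

theorem continuousOn_V (h : IsMajorant S ρ τ) (hr : 1 ≤ r) :
    ContinuousOn (fun z => V S r z 1) (Metric.closedBall 0 ρ) := by
  have : ContinuousOn (fun z => ∑' T : PlaneTree, T.weight S r z 1) (Metric.closedBall 0 ρ) := by
    refine continuousOn_tsum (fun T => ?_) h.summable_bound fun T z hz => ?_
    · simp only [weight_eq hr]
      split_ifs <;> fun_prop
    · have hz : ‖z‖ ≤ ρ := by simpa using hz
      exact norm_weight_le hr hz (by simpa using hz) T
  exact this.congr fun z hz => h.V_one_eq hr (by simpa using hz)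

/-- In `t`, the function `V(z, t)` is analytic near `1` as a normally convergent series. -/
theorem differentiableOn_V (h : IsMajorant S ρ τ) (hr : 1 ≤ r) {z : ℂ} (hz : ‖z‖ ≤ ρ) :
    DifferentiableOn ℂ (fun t => V S r z t) {t | ‖z‖ * ‖t‖ < ρ} := by
  have : DifferentiableOn ℂ (fun t => ∑' T : PlaneTree, T.weight S r z t)
      {t | ‖z‖ * ‖t‖ < ρ} := by
    refine Complex.differentiableOn_tsum_of_summable_norm h.summable_bound (fun T => ?_) ?_
      fun T t ht => norm_weight_le hr hz (le_of_lt ht) T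
    · simp only [weight_eq hr]
      split_ifs <;> fun_prop
    · exact isOpen_lt (by fun_prop) (by fun_prop)
  exact this.congr fun t ht => h.V_eq hr hz (le_of_lt ht)

theorem eventually_mul_norm_lt {z : ℂ} (hz : ‖z‖ < ρ) : ∀ᶠ t in 𝓝 (1 : ℂ), ‖z‖ * ‖t‖ < ρ :=
  (isOpen_lt (by fun_prop) (by fun_prop) : IsOpen {t : ℂ | ‖z‖ * ‖t‖ < ρ}).mem_nhds
    (by simpa using hz)

theorem analyticAt_V (h : IsMajorant S ρ τ) (hr : 1 ≤ r) {z : ℂ} (hz : ‖z‖ < ρ) :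
    AnalyticAt ℂ (fun t => V S r z t) 1 :=
  (h.differentiableOn_V hr hz.le).analyticAt (eventually_mul_norm_lt hz)

theorem V_ofReal (h : IsMajorant S ρ τ) (hr : 1 ≤ r) {x : ℝ} (hx : 0 ≤ x) (hxρ : x ≤ ρ) :
    ∃ y : ℝ, 0 ≤ y ∧ y ≤ τ ∧ V S r x 1 = y := by
  have hz : ‖(x : ℂ)‖ ≤ ρ := by rwa [Complex.norm_real, Real.norm_of_nonneg hx]
  have hy : V S r x 1 = (∑' T : PlaneTree, T.sizeWeight S x : ℝ) := by
    rw [h.V_one_eq hr hz, Complex.ofReal_tsum]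
    refine tsum_congr fun T => ?_
    rw [weight_eq hr, sizeWeight]
    split_ifs <;> simp
  have hy0 : 0 ≤ ∑' T : PlaneTree, T.sizeWeight S x := tsum_nonneg (sizeWeight_nonneg hx)
  refine ⟨_, hy0, ?_, hy⟩
  have := h.norm_V_le hr hz
  rwa [hy, Complex.norm_real, Real.norm_of_nonneg hy0] at this

/-- If `d` divides all outdegrees, all tree sizes are `1` modulo `d`; so rotating `z` by a `d`-th
root of unity rotates `V`. -/
theorem V_mul_rootOfUnity (h : IsMajorant S ρ τ) (hr : 1 ≤ r) {z ζ : ℂ} (hz : ‖z‖ ≤ ρ)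
    (hζ1 : ‖ζ‖ = 1) (hζ : ∀ d ∈ upSteps S, ζ ^ (d + 1) = 1) :
    V S r (ζ * z) 1 = ζ * V S r z 1 := by
  have hsize : ∀ T : PlaneTree, T.DegreesIn S → ζ ^ T.size = ζ := by
    intro T
    induction T with
    | node d c ih =>
      intro hT
      rw [DegreesIn] at hT
      rw [size, pow_add, pow_one, ← Finset.prod_pow_eq_pow_sum,
        Finset.prod_congr rfl fun i _ => ih i (hT.2 i)]
      rcases d with _ | d
      · simp
      · rw [Finset.prod_const, Finset.card_univ, Fintype.card_fin, hζ d, mul_one]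
        simpa [mem_upSteps] using hT.1
  rw [h.V_one_eq hr hz, h.V_one_eq hr (by rwa [norm_mul, hζ1, one_mul]), ← tsum_mul_left]
  refine tsum_congr fun T => ?_
  rw [weight_eq hr, weight_eq hr]
  split_ifs with hT
  · rw [mul_pow, hsize T hT, mul_assoc]
  · simp

end IsMajorant

/-! ### Derivatives with respect to the ascent variable -/

/-- A pair `(ρ, τ)` as in `IsMajorant` at which the equation `u = z φ(u)` is critical:
`ρ φ'(τ) = 1`. -/
structure IsCritical (S : Finset ℤ) (ρ τ : ℝ) : Prop extends IsMajorant S ρ τ where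
  critical : ρ * (Polynomial.aeval τ (upPoly S) +
    τ * Polynomial.aeval τ (Polynomial.derivative (upPoly S))) = 1
  exists_up : ∃ d ∈ upSteps S, 1 ≤ d

theorem aeval_derivative_upPoly {K : Type*} [CommRing K] (S : Finset ℤ) (u : K) :
    Polynomial.aeval u (Polynomial.derivative (upPoly S)) =
      ∑ d ∈ upSteps S, (d : K) * u ^ (d - 1) := by
  simp [upPoly, Polynomial.derivative_X_pow]

theorem norm_aeval_derivative_upPoly_le (S : Finset ℤ) (u : ℂ) {x : ℝ} (hu : ‖u‖ ≤ x) :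
    ‖Polynomial.aeval u (Polynomial.derivative (upPoly S))‖ ≤
      Polynomial.aeval x (Polynomial.derivative (upPoly S)) := by
  rw [aeval_derivative_upPoly, aeval_derivative_upPoly]
  refine (norm_sum_le _ _).trans (Finset.sum_le_sum fun d _ => ?_)
  rw [norm_mul, norm_pow, Complex.norm_natCast]
  gcongr

theorem hasDerivAt_aeval_comp {z t v' : ℂ} {v : ℂ → ℂ} (hv : HasDerivAt v v' t)
    (P : MvPolynomial (Fin 3) ℤ) :
    HasDerivAt (fun t => MvPolynomial.aeval ![z, t, v t] P)
      (MvPolynomial.aeval ![z, t, v t] (MvPolynomial.pderiv 1 P) +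
        MvPolynomial.aeval ![z, t, v t] (MvPolynomial.pderiv 2 P) * v') t := by
  induction P using MvPolynomial.induction_on with
  | C a => simpa using hasDerivAt_const t _
  | add p q hp hq =>
    simp only [map_add]
    exact (hp.add hq).congr_deriv (by ring)
  | mul_X p i hp =>
    have hX : HasDerivAt (fun t => ![z, t, v t] i)
        ((Pi.single i 1 : Fin 3 → ℂ) 1 + (Pi.single i 1 : Fin 3 → ℂ) 2 * v') t := by
      fin_cases i
      · simpa using hasDerivAt_const t z
      · simpa using hasDerivAt_id' t
      · simpa using hv
    simp only [map_mul, MvPolynomial.aeval_X, Derivation.leibniz, map_add, smul_eq_mul,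
      MvPolynomial.pderiv_X]
    refine (hp.mul hX).congr_deriv ?_
    fin_cases i <;> simp <;> ring

/-- The polynomial `G(z, t, v)` whose vanishing at `v = V(z, t)` is the functional equation. -/
def kernelPoly (S : Finset ℤ) (r : ℕ) : MvPolynomial (Fin 3) ℤ :=
  let x := MvPolynomial.X 0
  let w := x * Polynomial.aeval (MvPolynomial.X 2) (upPoly S)
  MvPolynomial.X 2 * (1 - w) - x - (MvPolynomial.X 1 - 1) * (x * w ^ r) * (1 - w)

theorem aeval_kernelPoly (S : Finset ℤ) (r : ℕ) (z t v : ℂ) :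
    MvPolynomial.aeval ![z, t, v] (kernelPoly S r) =
      v * (1 - z * Polynomial.aeval v (upPoly S)) - z -
        (t - 1) * (z * (z * Polynomial.aeval v (upPoly S)) ^ r) *
          (1 - z * Polynomial.aeval v (upPoly S)) := by
  simp [kernelPoly, ← Polynomial.aeval_algHom_apply]

theorem aeval_pderiv_one_kernelPoly (S : Finset ℤ) (r : ℕ) (z t v : ℂ) :
    MvPolynomial.aeval ![z, t, v] (MvPolynomial.pderiv 1 (kernelPoly S r)) =
      -(z * (z * Polynomial.aeval v (upPoly S)) ^ r) *
          (1 - z * Polynomial.aeval v (upPoly S)) := by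
  simp [kernelPoly, ← Polynomial.aeval_algHom_apply, Derivation.leibniz, Derivation.leibniz_pow,
    Derivation.map_aeval, MvPolynomial.pderiv_X]
  ring

theorem aeval_pderiv_two_kernelPoly (S : Finset ℤ) (r : ℕ) (z v : ℂ) :
    MvPolynomial.aeval ![z, 1, v] (MvPolynomial.pderiv 2 (kernelPoly S r)) =
      1 - z * (Polynomial.aeval v (upPoly S) +
        v * Polynomial.aeval v (Polynomial.derivative (upPoly S))) := by
  simp [kernelPoly, ← Polynomial.aeval_algHom_apply, Derivation.leibniz, Derivation.leibniz_pow,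
    Derivation.map_aeval, MvPolynomial.pderiv_X]
  ring

namespace IsCritical

variable {S : Finset ℤ} {ρ τ : ℝ} {r : ℕ}

/-- `1 - z φ'(V(z)) ≠ 0`, because `φ'` has nonnegative coefficients and `ρ φ'(τ) = 1`. -/
theorem one_sub_ne_zero (h : IsCritical S ρ τ) {z v : ℂ} (hz : ‖z‖ < ρ) (hv : ‖v‖ ≤ τ) :
    1 - z * (Polynomial.aeval v (upPoly S) +
        v * Polynomial.aeval v (Polynomial.derivative (upPoly S))) ≠ 0 := by
  intro h0
  have h1 : ‖Polynomial.aeval v (upPoly S) +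
      v * Polynomial.aeval v (Polynomial.derivative (upPoly S))‖ ≤
      Polynomial.aeval τ (upPoly S) +
        τ * Polynomial.aeval τ (Polynomial.derivative (upPoly S)) := by
    refine (norm_add_le _ _).trans (add_le_add (norm_aeval_upPoly_le S v hv) ?_)
    rw [norm_mul]
    exact mul_le_mul hv (norm_aeval_derivative_upPoly_le S v hv) (norm_nonneg _) h.tau_pos.le
  have h2 := congrArg norm (sub_eq_zero.mp h0)
  rw [norm_one, norm_mul] at h2
  have hc := h.critical
  set A := Polynomial.aeval τ (upPoly S) +
        τ * Polynomial.aeval τ (Polynomial.derivative (upPoly S))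
  have hA : 0 < A := by
    by_contra hA
    nlinarith [h.rho_pos]
  nlinarith [mul_le_mul_of_nonneg_left h1 (norm_nonneg z)]

/-- Implicit differentiation of the functional equation. -/
theorem eventually_hasDerivAt (h : IsCritical S ρ τ) (hr : 1 ≤ r) {z : ℂ} (hz : ‖z‖ < ρ) :
    ∀ᶠ t in 𝓝 (1 : ℂ),
      MvPolynomial.aeval ![z, t, V S r z t] (MvPolynomial.pderiv 2 (kernelPoly S r)) ≠ 0 ∧
      HasDerivAt (fun t => V S r z t)
        (-MvPolynomial.aeval ![z, t, V S r z t] (MvPolynomial.pderiv 1 (kernelPoly S r)) /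
          MvPolynomial.aeval ![z, t, V S r z t] (MvPolynomial.pderiv 2 (kernelPoly S r))) t := by
  have hsmall := IsMajorant.eventually_mul_norm_lt hz
  have hd1 : DifferentiableAt ℂ (fun t => V S r z t) 1 := (h.analyticAt_V hr hz).differentiableAt
  have hne : ∀ᶠ t in 𝓝 (1 : ℂ),
      MvPolynomial.aeval ![z, t, V S r z t] (MvPolynomial.pderiv 2 (kernelPoly S r)) ≠ 0 := by
    refine ContinuousAt.eventually_ne
      (hasDerivAt_aeval_comp hd1.hasDerivAt _).continuousAt ?_
    rw [aeval_pderiv_two_kernelPoly]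
    exact h.one_sub_ne_zero hz (h.norm_V_le hr hz.le)
  filter_upwards [hne, hsmall.eventually_nhds] with t hD ht
  refine ⟨hD, ?_⟩
  have hdt : HasDerivAt (fun t => V S r z t) (deriv (fun t => V S r z t) t) t :=
    ((h.differentiableOn_V hr hz.le).differentiableAt ht).hasDerivAt
  have hG : (fun t => MvPolynomial.aeval ![z, t, V S r z t] (kernelPoly S r)) =ᶠ[𝓝 t]
      fun _ => 0 := by
    filter_upwards [ht] with t ht
    rw [aeval_kernelPoly, h.functional_equation hr hz.le ht.le]
    ring
  have h0 := ((hasDerivAt_const t (0 : ℂ)).congr_of_eventuallyEq hG).unique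
    (hasDerivAt_aeval_comp hdt (kernelPoly S r))
  convert hdt using 1
  rw [div_eq_iff hD]
  linear_combination h0

/-- All `t`-derivatives of `V` near `t = 1` are quotients of a polynomial in `z, t, V` by a power
of `∂G/∂v`, by induction with the quotient rule. -/
theorem exists_iteratedDeriv_eq (h : IsCritical S ρ τ) (hr : 1 ≤ r) (ν : ℕ) :
    ∃ (N : MvPolynomial (Fin 3) ℤ) (m : ℕ), ∀ z : ℂ, ‖z‖ < ρ → ∀ᶠ t in 𝓝 (1 : ℂ),
      iteratedDeriv ν (fun t => V S r z t) t = MvPolynomial.aeval ![z, t, V S r z t] N /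
        MvPolynomial.aeval ![z, t, V S r z t] (MvPolynomial.pderiv 2 (kernelPoly S r)) ^ m := by
  induction ν with
  | zero => exact ⟨MvPolynomial.X 2, 0, fun z _ => by simp⟩
  | succ ν ih =>
    obtain ⟨N, m, hN⟩ := ih
    set D := MvPolynomial.pderiv 2 (kernelPoly S r) with hD
    set E := MvPolynomial.pderiv 1 (kernelPoly S r) with hE
    -- With `V' = -E / D`, the derivative of `N / D ^ m` has denominator `D ^ (m + 2)`.
    refine ⟨(MvPolynomial.pderiv 1 N * D - MvPolynomial.pderiv 2 N * E) * D -
      (m : MvPolynomial (Fin 3) ℤ) * N *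
        (MvPolynomial.pderiv 1 D * D - MvPolynomial.pderiv 2 D * E), m + 2, fun z hz => ?_⟩
    filter_upwards [(hN z hz).eventually_nhds, h.eventually_hasDerivAt hr hz] with t ht hdt
    rw [← hD, ← hE] at hdt
    obtain ⟨hD0, hv⟩ := hdt
    have hq := (hasDerivAt_aeval_comp (z := z) hv N).div ((hasDerivAt_aeval_comp hv D).pow m)
      (pow_ne_zero m hD0)
    rw [iteratedDeriv_succ, Filter.EventuallyEq.deriv_eq ht]
    refine hq.deriv.trans ?_
    simp only [map_sub, map_mul, map_natCast]
    rcases m with _ | m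
    · field_simp
      simp
      ring
    · field_simp
      simp
      ring

theorem exists_rational (h : IsCritical S ρ τ) (hr : 1 ≤ r) (ν : ℕ) :
    ∃ P Q : MvPolynomial (Fin 2) ℤ, ∀ z : ℂ, ‖z‖ < ρ →
      MvPolynomial.aeval ![z, V S r z 1] Q ≠ 0 ∧
      iteratedDeriv ν (fun t => V S r z t) 1 =
        MvPolynomial.aeval ![z, V S r z 1] P / MvPolynomial.aeval ![z, V S r z 1] Q := by
  obtain ⟨N, m, hN⟩ := h.exists_iteratedDeriv_eq hr ν
  let e : MvPolynomial (Fin 3) ℤ →ₐ[ℤ] MvPolynomial (Fin 2) ℤ :=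
    MvPolynomial.aeval ![MvPolynomial.X 0, 1, MvPolynomial.X 1]
  have he : ∀ (z v : ℂ) (P : MvPolynomial (Fin 3) ℤ),
      MvPolynomial.aeval ![z, v] (e P) = MvPolynomial.aeval ![z, 1, v] P := by
    intro z v P
    rw [← AlgHom.comp_apply, MvPolynomial.comp_aeval]
    congr 2
    ext i
    fin_cases i <;> simp
  refine ⟨e N, e (MvPolynomial.pderiv 2 (kernelPoly S r) ^ m), fun z hz => ?_⟩
  rw [he, he, map_pow]
  exact ⟨pow_ne_zero _ (h.eventually_hasDerivAt hr hz).self_of_nhds.1, (hN z hz).self_of_nhds⟩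

theorem _root_.Lukasiewicz.hasDerivAt_stepGF {K : Type*} [NontriviallyNormedField K]
    (hS : IsStepSet S) {u : K} (hu : u ≠ 0) :
    HasDerivAt (stepGF S)
      (-(u ^ 2)⁻¹ + Polynomial.aeval u (Polynomial.derivative (upPoly S))) u := by
  have : stepGF S = fun u : K => u⁻¹ + Polynomial.aeval u (upPoly S) := funext (stepGF_eq hS)
  rw [this]
  exact (hasDerivAt_inv hu).add ((upPoly S).hasDerivAt_aeval u)

theorem V_ne_zero (h : IsCritical S ρ τ) (hr : 1 ≤ r) {z : ℂ} (hz0 : z ≠ 0) (hz : ‖z‖ ≤ ρ) :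
    V S r z 1 ≠ 0 := by
  intro hV
  have := h.functional_equation_one hr hz
  rw [hV] at this
  exact hz0 (by linear_combination -this)

theorem deriv_stepGF_V_ne_zero (h : IsCritical S ρ τ) (hr : 1 ≤ r) {z : ℂ} (hz0 : z ≠ 0)
    (hz : ‖z‖ < ρ) : deriv (stepGF S) (V S r z 1) ≠ 0 := by
  have hV := h.V_ne_zero hr hz0 hz.le
  rw [(hasDerivAt_stepGF h.isStepSet hV).deriv]
  intro h0
  have hf := h.functional_equation_one hr hz.le
  refine h.one_sub_ne_zero hz (h.norm_V_le hr hz.le) ?_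
  field_simp at h0
  refine mul_left_cancel₀ hV ?_
  linear_combination hf - z * h0

theorem hasDerivAt_V (h : IsCritical S ρ τ) (hr : 1 ≤ r) {z : ℂ} (hz0 : z ≠ 0) (hz : ‖z‖ < ρ) :
    HasDerivAt (fun t => V S r z t)
      (-z * ((V S r z 1 - z) ^ r /
        (V S r z 1 ^ (r + 2) * deriv (stepGF S) (V S r z 1)))) 1 := by
  have hV := h.V_ne_zero hr hz0 hz.le
  have hS' := h.deriv_stepGF_V_ne_zero hr hz0 hz
  have hf := h.functional_equation_one hr hz.le
  obtain ⟨hD, hd⟩ := (h.eventually_hasDerivAt hr hz).self_of_nhds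
  refine hd.congr_deriv ?_
  rw [aeval_pderiv_two_kernelPoly] at hD ⊢
  rw [aeval_pderiv_one_kernelPoly]
  have hS1 := (hasDerivAt_stepGF h.isStepSet hV).deriv
  set v := V S r z 1
  set s := deriv (stepGF S) v
  have hw : z * Polynomial.aeval v (upPoly S) = (v - z) / v := by
    rw [eq_div_iff hV]
    linear_combination -hf
  have hs : 1 - z * (Polynomial.aeval v (upPoly S) +
      v * Polynomial.aeval v (Polynomial.derivative (upPoly S))) = -(z * v * s) := by
    rw [mul_add, hw, hS1]
    field_simp
    ring
  rw [hs, hw, div_pow]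
  field_simp
  ring

end IsCritical

/-! ### The period -/

theorem mul_stepGF {S : Finset ℤ} (hS : IsStepSet S) {u : ℂ} (hu : u ≠ 0) :
    u * stepGF S u = 1 + ∑ d ∈ upSteps S, u ^ (d + 1) := by
  rw [stepGF_eq hS, aeval_upPoly, mul_add, mul_inv_cancel₀ hu, Finset.mul_sum]
  simp only [pow_succ']

theorem IsPeriod.pos {S : Finset ℤ} {p : ℕ} (hp : IsPeriod S p) (hS : IsStepSet S) : 0 < p := by
  refine hp.2 ⟨1 + ∑ d ∈ upSteps S, Polynomial.X ^ (d + 1), fun u hu => ?_⟩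
  rw [mul_stepGF hS hu]
  simp [Polynomial.eval_finsetSum]

theorem IsPeriod.dvd {S : Finset ℤ} {p : ℕ} (hp : IsPeriod S p) (hS : IsStepSet S) {d : ℕ}
    (hd : d ∈ upSteps S) : p ∣ d + 1 := by
  have hp0 := hp.pos hS
  obtain ⟨Q, hQ⟩ := hp.1
  have hpoly : 1 + ∑ d ∈ upSteps S, Polynomial.X ^ (d + 1) = Polynomial.expand ℂ p Q := by
    refine Polynomial.eq_of_infinite_eval_eq _ _
      (Set.Infinite.mono (s := {0}ᶜ) (fun u hu => ?_) (Set.finite_singleton 0).infinite_compl)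
    have h := hQ u hu
    rw [mul_stepGF hS hu] at h
    simpa [Polynomial.eval_finsetSum, Polynomial.expand_eval] using h
  have hc := congrArg (fun P => Polynomial.coeff P (d + 1)) hpoly
  simp only [Polynomial.coeff_expand hp0, Polynomial.coeff_add, Polynomial.finsetSum_coeff,
    Polynomial.coeff_X_pow, Polynomial.coeff_one] at hc
  by_contra hnd
  simp [hnd, hd] at hc

/-- The least common multiple of `p` and the order of `ω` divides every `d + 1`, so it is admissible
in the definition of the period; by maximality, the order divides `p`. -/
theorem IsPeriod.pow_eq_one {S : Finset ℤ} {p : ℕ} (hp : IsPeriod S p) (hS : IsStepSet S)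
    {d₀ : ℕ} (hd₀ : d₀ ∈ upSteps S) {ω : ℂ} (hω : ∀ d ∈ upSteps S, ω ^ (d + 1) = 1) :
    ω ^ p = 1 := by
  have hl : ∀ d ∈ upSteps S, Nat.lcm p (orderOf ω) ∣ d + 1 := fun d hd =>
    Nat.lcm_dvd (hp.dvd hS hd) (orderOf_dvd_of_pow_eq_one (hω d hd))
  have hle : Nat.lcm p (orderOf ω) ≤ p := by
    refine hp.2 ⟨1 + ∑ d ∈ upSteps S, Polynomial.X ^ ((d + 1) / Nat.lcm p (orderOf ω)),
      fun u hu => ?_⟩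
    rw [mul_stepGF hS hu]
    simp only [Polynomial.eval_add, Polynomial.eval_one, Polynomial.eval_finsetSum,
      Polynomial.eval_pow, Polynomial.eval_X, ← pow_mul]
    congr 1
    exact Finset.sum_congr rfl fun d hd => by rw [Nat.mul_div_cancel' (hl d hd)]
  have hpos : 0 < Nat.lcm p (orderOf ω) := Nat.pos_of_dvd_of_pos (hl d₀ hd₀) d₀.succ_pos
  have heq : Nat.lcm p (orderOf ω) = p :=
    le_antisymm hle (Nat.le_of_dvd hpos (Nat.dvd_lcm_left _ _))
  exact orderOf_dvd_iff_pow_eq_one.mp (heq ▸ Nat.dvd_lcm_right _ _)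

/-! ### The critical point -/

theorem strictMonoOn_sq_mul_derivative {S : Finset ℤ} (hup : ∃ d ∈ upSteps S, 1 ≤ d) :
    StrictMonoOn (fun u : ℝ => u ^ 2 * Polynomial.aeval u (Polynomial.derivative (upPoly S)))
      (Set.Ici 0) := by
  intro a ha b hb hab
  have ha : 0 ≤ a := ha
  simp only [aeval_derivative_upPoly]
  obtain ⟨d, hd, hd1⟩ := hup
  have hb0 : 0 < b := ha.trans_lt hab
  have h1 : ∑ d ∈ upSteps S, (d : ℝ) * a ^ (d - 1) ≤ ∑ d ∈ upSteps S, (d : ℝ) * b ^ (d - 1) :=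
    Finset.sum_le_sum fun d _ => by gcongr
  have h2 : 0 < ∑ d ∈ upSteps S, (d : ℝ) * b ^ (d - 1) :=
    Finset.sum_pos' (fun d _ => by positivity) ⟨d, hd, by positivity⟩
  calc a ^ 2 * ∑ d ∈ upSteps S, (d : ℝ) * a ^ (d - 1)
      ≤ a ^ 2 * ∑ d ∈ upSteps S, (d : ℝ) * b ^ (d - 1) := by gcongr
    _ < b ^ 2 * ∑ d ∈ upSteps S, (d : ℝ) * b ^ (d - 1) := by gcongr

theorem deriv_stepGF_eq_zero_iff {K : Type*} [NontriviallyNormedField K] {S : Finset ℤ}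
    (hS : IsStepSet S) {u : K} (hu : u ≠ 0) :
    deriv (stepGF S) u = 0 ↔
      u ^ 2 * Polynomial.aeval u (Polynomial.derivative (upPoly S)) = 1 := by
  rw [(hasDerivAt_stepGF hS hu).deriv, neg_add_eq_zero]
  constructor
  · intro h
    rw [← h, mul_inv_cancel₀ (pow_ne_zero 2 hu)]
  · intro h
    exact inv_eq_of_mul_eq_one_right h

theorem exists_mem_upSteps {S : Finset ℤ} (hup : ∃ s ∈ S, 1 ≤ s) : ∃ d ∈ upSteps S, 1 ≤ d := by
  obtain ⟨s, hs, h1⟩ := hup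
  refine ⟨s.toNat, ?_, by omega⟩
  rw [mem_upSteps, Int.toNat_of_nonneg (by omega)]
  exact hs

theorem existsUnique_deriv_stepGF_eq_zero {S : Finset ℤ} (hS : IsStepSet S)
    (hup : ∃ d ∈ upSteps S, 1 ≤ d) : ∃! τ : ℝ, 0 < τ ∧ deriv (stepGF S) τ = 0 := by
  set g := fun u : ℝ => u ^ 2 * Polynomial.aeval u (Polynomial.derivative (upPoly S)) with hg
  have hmono := strictMonoOn_sq_mul_derivative hup
  have hcont : Continuous g := (continuous_pow 2).mul (Polynomial.continuous_aeval _)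
  have h1 : 1 ≤ g 1 := by
    obtain ⟨d, hd, hd1⟩ := hup
    simp only [hg, aeval_derivative_upPoly, one_pow, one_mul, mul_one]
    calc (1 : ℝ) ≤ d := by exact_mod_cast hd1
      _ ≤ _ := Finset.single_le_sum (f := fun d : ℕ => (d : ℝ)) (fun _ _ => by positivity) hd
  obtain ⟨τ, hτ, hτ1⟩ := intermediate_value_Icc (zero_le_one (α := ℝ)) hcont.continuousOn
    (show (1 : ℝ) ∈ Set.Icc (g 0) (g 1) from ⟨by simp [hg], h1⟩)
  have hτ0 : 0 < τ := by
    refine hτ.1.lt_of_ne ?_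
    rintro rfl
    simp [hg] at hτ1
  refine ⟨τ, ⟨hτ0, (deriv_stepGF_eq_zero_iff hS hτ0.ne').mpr hτ1⟩, ?_⟩
  rintro σ ⟨hσ0, hσ⟩
  rw [deriv_stepGF_eq_zero_iff hS hσ0.ne'] at hσ
  exact hmono.injOn hσ0.le hτ0.le (hσ.trans hτ1.symm)

theorem isCritical_of_deriv_eq_zero {S : Finset ℤ} (hS : IsStepSet S)
    (hup : ∃ d ∈ upSteps S, 1 ≤ d) {τ : ℝ} (hτ : 0 < τ) (hd : deriv (stepGF S) τ = 0) :
    IsCritical S (1 / stepGF S τ) τ := by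
  have hU : 0 ≤ Polynomial.aeval τ (upPoly S) := by
    rw [aeval_upPoly]; positivity
  have hd' := (deriv_stepGF_eq_zero_iff hS hτ.ne').mp hd
  have hpos : 0 < 1 + τ * Polynomial.aeval τ (upPoly S) := by positivity
  have hs : 1 / stepGF S τ = τ / (1 + τ * Polynomial.aeval τ (upPoly S)) := by
    rw [stepGF_eq hS]; field_simp
  refine ⟨⟨hS, ?_, hτ, ?_⟩, ?_, hup⟩
  · rw [hs]; positivity
  · rw [hs]; field_simp
  · rw [hs]
    field_simp
    linear_combination hd'

namespace IsCritical

variable {S : Finset ℤ} {ρ τ : ℝ} {r : ℕ}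

theorem stepGF_tau (h : IsCritical S ρ τ) : stepGF S τ = 1 / ρ := by
  have := h.tau_pos
  have := h.rho_pos
  rw [stepGF_eq h.isStepSet]
  field_simp
  linear_combination h.eq

theorem sq_mul_derivative (h : IsCritical S ρ τ) :
    τ ^ 2 * Polynomial.aeval τ (Polynomial.derivative (upPoly S)) = 1 := by
  have hρ := h.rho_pos.ne'
  refine mul_left_cancel₀ hρ ?_
  linear_combination τ * h.critical - h.eq

theorem deriv_stepGF_tau (h : IsCritical S ρ τ) : deriv (stepGF S) τ = 0 :=
  (deriv_stepGF_eq_zero_iff h.isStepSet h.tau_pos.ne').mpr h.sq_mul_derivative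

/-- A point of the closed disc of radius `τ` that is critical for `S` and is mapped to modulus
`ρ` by `1 / S` is `τ` times a root of unity: all terms of `u S(u)` are aligned there. -/
theorem exists_eq_mul_of_deriv_eq_zero (h : IsCritical S ρ τ) {z v : ℂ} (hv0 : v ≠ 0)
    (hvτ : ‖v‖ ≤ τ) (hz : ‖z‖ = ρ) (hzv : v = z * (1 + v * Polynomial.aeval v (upPoly S)))
    (hd : deriv (stepGF S) v = 0) :
    ∃ ω : ℂ, (∀ d ∈ upSteps S, ω ^ (d + 1) = 1) ∧ z = ω * ρ := by
  have hτ := h.tau_pos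
  have hρ := h.rho_pos
  -- `u ^ 2 * U'(u)` has nonnegative coefficients and takes the value `1` at `τ` and at `v`.
  have hnorm : ‖v‖ = τ := by
    refine hvτ.antisymm ?_
    by_contra hlt
    have h1 := strictMonoOn_sq_mul_derivative h.exists_up (norm_nonneg v) hτ.le (not_le.mp hlt)
    simp only [h.sq_mul_derivative] at h1
    rw [deriv_stepGF_eq_zero_iff h.isStepSet hv0] at hd
    have h2 := congrArg norm hd
    rw [norm_mul, norm_pow, norm_one] at h2
    have h3 := mul_le_mul_of_nonneg_left (norm_aeval_derivative_upPoly_le S v le_rfl)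
      (sq_nonneg ‖v‖)
    linarith
  -- Taking norms in `v = z φ(v)`: the triangle inequality for `φ(v)` is an equality.
  have hφ : ‖1 + ∑ d ∈ upSteps S, v ^ (d + 1)‖ = 1 + ∑ d ∈ upSteps S, τ ^ (d + 1) := by
    have h1 := congrArg norm hzv
    rw [norm_mul, hz, hnorm, aeval_upPoly, Finset.mul_sum] at h1
    have h2 := h.eq
    rw [aeval_upPoly, Finset.mul_sum] at h2
    simp only [← pow_succ'] at h1 h2
    exact mul_left_cancel₀ hρ.ne' (h1.symm.trans h2.symm)
  have hal : ∀ d ∈ upSteps S, v ^ (d + 1) = τ ^ (d + 1) := by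
    intro d hd
    have hn : ‖v ^ (d + 1)‖ = τ ^ (d + 1) := by rw [norm_pow, hnorm]
    have hsum : ‖1 + v ^ (d + 1)‖ = ‖(1 : ℂ)‖ + ‖v ^ (d + 1)‖ := by
      refine (norm_add_le _ _).antisymm ?_
      rw [norm_one, hn]
      have h1 : ‖1 + ∑ d ∈ upSteps S, v ^ (d + 1)‖ ≤
          ‖1 + v ^ (d + 1)‖ + ∑ e ∈ (upSteps S).erase d, τ ^ (e + 1) := by
        rw [← Finset.add_sum_erase _ _ hd, ← add_assoc]
        refine (norm_add_le _ _).trans (add_le_add_right ((norm_sum_le _ _).trans ?_) _)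
        exact Finset.sum_le_sum fun e _ => by rw [norm_pow, hnorm]
      rw [hφ, ← Finset.add_sum_erase _ _ hd] at h1
      linarith
    have hray := (sameRay_iff_norm_add.mpr hsum).norm_smul_eq
    rw [norm_one, hn, one_smul] at hray
    simpa using hray
  refine ⟨v / τ, fun d hd => ?_, ?_⟩
  · rw [div_pow, hal d hd]
    exact div_self (pow_ne_zero _ (by exact_mod_cast hτ.ne'))
  · have h1 : (1 + v * Polynomial.aeval v (upPoly S)) =
        ((1 + τ * Polynomial.aeval τ (upPoly S) : ℝ) : ℂ) := by
      rw [aeval_upPoly, aeval_upPoly, Finset.mul_sum, Finset.mul_sum]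
      push_cast
      congr 1
      exact Finset.sum_congr rfl fun d hd => by
        rw [← pow_succ', ← pow_succ', hal d hd]
    have hτ' : (τ : ℂ) ≠ 0 := by exact_mod_cast hτ.ne'
    have h2 : (ρ : ℂ) * ((1 + τ * Polynomial.aeval τ (upPoly S) : ℝ) : ℂ) = τ := by
      exact_mod_cast h.eq
    rw [h1] at hzv
    field_simp
    rw [← h2, hzv]
    ring

end IsCritical

/-! ### Higher derivatives of the characteristic polynomial -/

theorem iteratedDeriv_stepGF {K : Type*} [NontriviallyNormedField K] [CompleteSpace K]
    (S : Finset ℤ) {u : K}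
    (hu : u ≠ 0) (k : ℕ) :
    iteratedDeriv k (stepGF S) u =
      ∑ s ∈ S, (∏ i ∈ Finset.range k, ((s : K) - i)) * u ^ (s - k) := by
  have : stepGF S = fun u : K => ∑ s ∈ S, u ^ s := rfl
  rw [this, iteratedDeriv_fun_sum]
  · refine Finset.sum_congr rfl fun s _ => ?_
    rw [iteratedDeriv_eq_iterate, iter_deriv_zpow]
  · intro s _
    exact (analyticAt_id.zpow hu).contDiffAt

theorem iteratedDeriv_stepGF_ofReal (S : Finset ℤ) {x : ℝ} (hx : x ≠ 0) (k : ℕ) :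
    iteratedDeriv k (stepGF S) (x : ℂ) = (iteratedDeriv k (stepGF S) x : ℝ) := by
  rw [iteratedDeriv_stepGF S hx, iteratedDeriv_stepGF S (by exact_mod_cast hx)]
  push_cast
  rfl

theorem iteratedDeriv_two_stepGF_pos {S : Finset ℤ} (hS : IsStepSet S) {x : ℝ} (hx : 0 < x) :
    0 < iteratedDeriv 2 (stepGF S) x := by
  rw [iteratedDeriv_stepGF S hx.ne']
  refine Finset.sum_pos' (fun s hs => ?_) ⟨-1, hS.1, ?_⟩
  · refine mul_nonneg ?_ (zpow_nonneg hx.le _)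
    have : 0 ≤ s * (s - 1) := by
      rcases hS.2 s hs with rfl | h0
      · norm_num
      · rcases h0.eq_or_lt with rfl | h1
        · norm_num
        · exact mul_nonneg h0 (by omega)
    simpa [Finset.prod_range_succ] using (by exact_mod_cast this : (0 : ℝ) ≤ s * (s - 1))
  · refine mul_pos ?_ (zpow_pos hx _)
    norm_num [Finset.prod_range_succ]

/-! ### Square-root singularities of general functions -/

theorem re_one_sub_div_pos {ρ : ℝ} {w z : ℂ} (hw : ‖w‖ = ρ) (hz : ‖z‖ < ρ) :
    0 < (1 - z / w).re := by
  have h0 : 0 < ‖w‖ := hw ▸ (norm_nonneg z).trans_lt hz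
  have h1 : ‖z / w‖ < 1 := by rwa [norm_div, div_lt_one h0, hw]
  have h2 := (Complex.abs_re_le_norm (z / w)).trans_lt h1
  rw [Complex.sub_re, Complex.one_re]
  linarith [le_abs_self (z / w).re]

theorem cpow_half_sq (x : ℂ) : (x ^ (1 / 2 : ℂ)) ^ 2 = x := by
  rw [← Complex.cpow_nat_mul]
  norm_num

theorem cpow_half_ofReal_sq {x : ℝ} (hx : 0 ≤ x) : ((x : ℂ) ^ 2) ^ (1 / 2 : ℂ) = x := by
  rw [← Complex.ofReal_pow, show (1 / 2 : ℂ) = ((1 / 2 : ℝ) : ℂ) by norm_num,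
    ← Complex.ofReal_cpow (by positivity), ← Real.sqrt_eq_rpow, Real.sqrt_sq hx]

/-- A square-root singularity is a singularity: if `f` extended analytically to `w` by `g`, then
`h x = g (w (1 - x ^ 2))` would have derivative `0` at `0`. -/
theorem IsSqrtSingularity.isSingularity {f : ℂ → ℂ} {ρ : ℝ} {w : ℂ} (hρ : 0 < ρ) (hw : ‖w‖ = ρ)
    (hf : IsSqrtSingularity f ρ w) : IsSingularity f ρ w := by
  rintro ⟨g, hg, hgf⟩
  obtain ⟨h, hh, hh', hfh⟩ := hf
  have hw0 : w ≠ 0 := norm_pos_iff.mp (hw ▸ hρ)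
  have hin : Filter.Tendsto (fun x : ℝ => w * (1 - (x : ℂ) ^ 2)) (𝓝[>] 0)
      (𝓝[Metric.ball 0 ρ] w) := by
    refine tendsto_nhdsWithin_iff.mpr ⟨?_, ?_⟩
    · have : ContinuousAt (fun x : ℝ => w * (1 - (x : ℂ) ^ 2)) 0 := by fun_prop
      have ht := this.tendsto
      simp only [Complex.ofReal_zero, ne_eq, OfNat.ofNat_ne_zero, not_false_eq_true, zero_pow,
        sub_zero, mul_one] at ht
      exact ht.mono_left nhdsWithin_le_nhds
    · filter_upwards [Ioo_mem_nhdsGT (zero_lt_one (α := ℝ))] with x hx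
      have h1 : 0 < 1 - x ^ 2 := by nlinarith [hx.1, hx.2]
      have h2 : ‖(1 - (x : ℂ) ^ 2)‖ = 1 - x ^ 2 := by
        rw [← Complex.ofReal_pow, ← Complex.ofReal_one, ← Complex.ofReal_sub, Complex.norm_real,
          Real.norm_of_nonneg h1.le]
      rw [mem_ball_zero_iff, norm_mul, hw, h2]
      nlinarith [pow_pos hx.1 2]
  have hev : ∀ᶠ x : ℝ in 𝓝[>] 0, g (w * (1 - (x : ℂ) ^ 2)) = h x := by
    filter_upwards [hin.eventually hgf, hin.eventually hfh, self_mem_nhdsWithin] with x h1 h2 hx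
    have hx : 0 < x := hx
    rw [h1, h2, mul_div_cancel_left₀ _ hw0, sub_sub_cancel, cpow_half_ofReal_sq hx.le]
  have hA : AnalyticAt ℂ (fun x : ℂ => g (w * (1 - x ^ 2))) 0 := by
    have : AnalyticAt ℂ (fun x : ℂ => w * (1 - x ^ 2)) 0 := by fun_prop
    exact AnalyticAt.comp (g := g) (by simpa using hg) this
  have hfreq : ∃ᶠ x in 𝓝[≠] (0 : ℂ), g (w * (1 - x ^ 2)) = h x := by
    have ht : Filter.Tendsto (fun x : ℝ => (x : ℂ)) (𝓝[>] 0) (𝓝[≠] 0) := by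
      refine tendsto_nhdsWithin_iff.mpr ⟨?_, ?_⟩
      · exact (Complex.continuous_ofReal.tendsto' 0 0 Complex.ofReal_zero).mono_left
          nhdsWithin_le_nhds
      · filter_upwards [self_mem_nhdsWithin] with x hx
        have hx : 0 < x := hx
        simpa using hx.ne'
    exact ht.frequently hev.frequently
  have heq := (hA.frequently_eq_iff_eventually_eq hh).mp hfreq
  apply hh'
  rw [← Filter.EventuallyEq.deriv_eq heq]
  have hgd : HasDerivAt g (deriv g w) (w * (1 - (0 : ℂ) ^ 2)) := by
    simpa using hg.differentiableAt.hasDerivAt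
  have hid : HasDerivAt (fun x : ℂ => w * (1 - x ^ 2)) 0 0 := by
    simpa using (((hasDerivAt_id' (0 : ℂ)).pow 2).const_sub 1).const_mul w
  exact (hgd.comp (0 : ℂ) hid).deriv.trans (mul_zero _)

/-- The composite of a function `h` analytic at `0` with the square root continues to a slit
neighbourhood, and a Taylor expansion of `h` turns into a singular expansion. -/
theorem hasSingularExpansion_of_sqrt {f : ℂ → ℂ} {ρ : ℝ} {w : ℂ} (hρ : 0 < ρ) (hw : ‖w‖ = ρ)
    {h E : ℂ → ℂ} (hh : AnalyticAt ℂ h 0)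
    (hf : ∀ᶠ z in 𝓝[Metric.ball 0 ρ] w, f z = h ((1 - z / w) ^ (1 / 2 : ℂ)))
    (hE : (fun x => h x - E x) =O[𝓝 0] fun x => x ^ 3) :
    HasSingularExpansion f ρ w (fun z => E ((1 - z / w) ^ (1 / 2 : ℂ)))
      (fun z => (1 - z / w) ^ (3 / 2 : ℂ)) := by
  have hw0 : w ≠ 0 := norm_pos_iff.mp (hw ▸ hρ)
  have hlim : Filter.Tendsto (fun z : ℂ => (1 - z / w) ^ (1 / 2 : ℂ)) (𝓝 w) (𝓝 0) := by
    have h1 : ContinuousAt (fun x : ℂ => x ^ (1 / 2 : ℂ)) 0 :=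
      Complex.continuousAt_cpow_const_of_re_pos (Or.inl le_rfl) (by norm_num)
    have h2 : Filter.Tendsto (fun z : ℂ => 1 - z / w) (𝓝 w) (𝓝 0) :=
      (show Continuous fun z : ℂ => 1 - z / w by fun_prop).tendsto' _ _ (by simp [hw0])
    have h3 : Filter.Tendsto (fun z : ℂ => (1 - z / w) ^ (1 / 2 : ℂ)) (𝓝 w)
      (𝓝 ((0 : ℂ) ^ (1 / 2 : ℂ))) := h1.tendsto.comp h2
    rwa [Complex.zero_cpow (by norm_num)] at h3
  obtain ⟨ε₁, hε₁, hA⟩ := Metric.eventually_nhds_iff_ball.mp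
    (hlim.eventually hh.eventually_analyticAt)
  obtain ⟨ε₂, hε₂, hf⟩ := Metric.mem_nhdsWithin_iff.mp hf
  refine ⟨min ε₁ ε₂, lt_min hε₁ hε₂, fun z => h ((1 - z / w) ^ (1 / 2 : ℂ)), ?_, ?_, ?_⟩
  · rintro z ⟨hz, hzs⟩
    refine AnalyticAt.comp (g := h) (hA z (Metric.ball_subset_ball (min_le_left _ _) hz)) ?_
    exact AnalyticAt.cpow (by fun_prop) analyticAt_const hzs
  · rintro z ⟨⟨hz, _⟩, hzρ⟩
    exact (hf ⟨Metric.ball_subset_ball (min_le_right _ _) hz, hzρ⟩).symm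
  · have h3 : ∀ z : ℂ, (1 - z / w) ^ (3 / 2 : ℂ) = ((1 - z / w) ^ (1 / 2 : ℂ)) ^ 3 := by
      intro z
      rw [← Complex.cpow_nat_mul]
      norm_num
    simp only [h3]
    exact (hE.comp_tendsto hlim).mono nhdsWithin_le_nhds

/-! ### Taylor expansion and local inverses -/

open Function in
theorem iterate_dslope_apply_self {f : ℂ → ℂ} {a : ℂ} (hf : AnalyticAt ℂ f a) (n : ℕ) :
    (swap dslope a)^[n] f a = iteratedDeriv n f a / n.factorial := by
  have h := (hf.hasFPowerSeriesAt.has_fpower_series_iterate_dslope_fslope n).coeff_zero 1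
  rw [← h]
  have := FormalMultilinearSeries.coeff_iterate_fslope (p := FormalMultilinearSeries.ofScalars ℂ
    (fun n => iteratedDeriv n f a / n.factorial)) n 0
  exact this.trans (by rw [zero_add, FormalMultilinearSeries.coeff_ofScalars])

/-- Third-order Taylor expansion with analytic remainder. -/
theorem exists_taylor_three {f : ℂ → ℂ} {a : ℂ} (hf : AnalyticAt ℂ f a) :
    ∃ n : ℂ → ℂ, AnalyticAt ℂ n a ∧ n a = iteratedDeriv 3 f a / 6 ∧
      ∀ u, f u = f a + deriv f a * (u - a) + iteratedDeriv 2 f a / 2 * (u - a) ^ 2 +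
        (u - a) ^ 3 * n u := by
  have hstep : ∀ (k : ℕ) (u : ℂ), ((Function.swap dslope a)^[k] f) u =
      ((Function.swap dslope a)^[k] f) a +
        (u - a) * ((Function.swap dslope a)^[k + 1] f) u := by
    intro k u
    rw [Function.iterate_succ_apply']
    have := sub_smul_dslope ((Function.swap dslope a)^[k] f) a u
    rw [smul_eq_mul] at this
    simp only [Function.swap]
    linear_combination -this
  refine ⟨_, ⟨_, hf.hasFPowerSeriesAt.has_fpower_series_iterate_dslope_fslope 3⟩, ?_, fun u => ?_⟩
  · rw [iterate_dslope_apply_self hf]; norm_num [Nat.factorial]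
  · have h0 := hstep 0 u
    have h1 := hstep 1 u
    have h2 := hstep 2 u
    rw [iterate_dslope_apply_self hf] at h0 h1 h2
    simp only [Function.iterate_zero, id, iteratedDeriv_zero, iteratedDeriv_one, Nat.factorial,
      zero_add] at h0 h1 h2
    norm_num at h0 h1 h2
    simp only [Function.iterate_succ, Function.iterate_zero, Function.comp_apply, id]
    linear_combination h0 + (u - a) * h1 + (u - a) ^ 2 * h2

theorem exists_local_inverse {q : ℂ → ℂ} {a : ℂ} (hq : AnalyticAt ℂ q a) (hq' : deriv q a ≠ 0) :
    ∃ h : ℂ → ℂ, AnalyticAt ℂ h (q a) ∧ h (q a) = a ∧ deriv h (q a) = (deriv q a)⁻¹ ∧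
      (∀ᶠ u in 𝓝 a, h (q u) = u) ∧ ∀ᶠ w in 𝓝 (q a), q (h w) = w :=
  ⟨_, hq.analyticAt_localInverse hq', HasStrictFDerivAt.localInverse_apply_image ..,
    (HasStrictDerivAt.to_localInverse hq.hasStrictDerivAt hq').hasDerivAt.deriv,
    HasStrictDerivAt.eventually_left_inverse .., HasStrictDerivAt.eventually_right_inverse ..⟩

/-! ### The singularity on the positive axis -/

theorem analyticAt_stepGF (S : Finset ℤ) {u : ℂ} (hu : u ≠ 0) : AnalyticAt ℂ (stepGF S) u := by
  have : stepGF S = fun u : ℂ => ∑ s ∈ S, u ^ s := rfl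
  rw [this]
  exact Finset.analyticAt_fun_sum _ fun s _ => analyticAt_id.zpow hu

/-- The Taylor coefficients of a local solution `h` of `S(h(w)) (1 - w ^ 2) = S(a)`, where `a` is
a critical point of `S`: the equation is divided by `w ^ 2` and by `w ^ 3`. -/
theorem isBigO_of_local_equation {s h n : ℂ → ℂ} {a A B c : ℂ} (hA : A ≠ 0) (hc : c ≠ 0)
    (hcA : A * c ^ 2 = s a) (hn : AnalyticAt ℂ n a) (hna : n a = B)
    (hs : ∀ u, s u = s a + A * (u - a) ^ 2 + (u - a) ^ 3 * n u)
    (hh : AnalyticAt ℂ h 0) (h0 : h 0 = a) (h1 : deriv h 0 = c)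
    (heq : ∀ᶠ w in 𝓝 0, s (h w) * (1 - w ^ 2) = s a) :
    (fun w => h w - (a + c * w - B * s a / (2 * A ^ 2) * w ^ 2)) =O[𝓝 0] fun w => w ^ 3 := by
  obtain ⟨R, hR, -, hT⟩ := exists_taylor_three hh
  set m₀ := iteratedDeriv 2 h 0 / 2 with hm₀
  simp only [h0, h1, sub_zero] at hT
  set m : ℂ → ℂ := fun w => m₀ + w * R w with hm
  have hmh : ∀ w, h w = a + w * (c + w * m w) := by
    intro w; rw [hT w, hm]; ring
  have hmc : ContinuousAt m 0 := by
    have := hR.continuousAt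
    fun_prop
  have hnc : ContinuousAt (fun w => n (h w)) 0 := by
    have : ContinuousAt n (h 0) := by rw [h0]; exact hn.continuousAt
    exact this.comp hh.continuousAt
  have hm0 : m 0 = m₀ := by simp [hm]
  -- The coefficient of `w ^ 3` in the equation, as a function that vanishes for small `w ≠ 0`.
  set L : ℂ → ℂ := fun w => 2 * A * c * m w + A * w * m w ^ 2 + (c + w * m w) ^ 3 * n (h w) -
    w * (c + w * m w) ^ 2 * (A + w * (c + w * m w) * n (h w)) with hL
  have hLc : ContinuousAt L 0 := by
    have haux : ∀ f g : ℂ → ℂ, ContinuousAt f 0 → ContinuousAt g 0 →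
        ContinuousAt (fun w => 2 * A * c * f w + A * w * f w ^ 2 + (c + w * f w) ^ 3 * g w -
          w * (c + w * f w) ^ 2 * (A + w * (c + w * f w) * g w)) 0 := by
      intro f g hf hg
      fun_prop
    exact haux m _ hmc hnc
  have hL0 : L 0 = 0 := by
    refine tendsto_nhds_unique (hLc.tendsto.mono_left nhdsWithin_le_nhds)
      (Filter.Tendsto.congr' (f₁ := fun _ => (0 : ℂ)) ?_ (tendsto_const_nhds (f := 𝓝[≠] 0)))
    filter_upwards [heq.filter_mono nhdsWithin_le_nhds, self_mem_nhdsWithin] with w hw hw0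
    have hw0 : w ≠ 0 := hw0
    have h2 := hs (h w)
    have h3 : h w - a = w * (c + w * m w) := by rw [hmh w]; ring
    rw [h3] at h2
    rw [h2] at hw
    refine (mul_left_cancel₀ (pow_ne_zero 3 hw0) ?_ : L w = 0).symm
    rw [hL]
    linear_combination hw - w ^ 2 * hcA
  have hm₀' : m₀ = -(B * s a / (2 * A ^ 2)) := by
    simp only [hL, hm0, h0, hna, mul_zero, zero_mul, add_zero, sub_zero] at hL0
    have : 2 * A * m₀ + c ^ 2 * B = 0 :=
      mul_left_cancel₀ hc (by linear_combination hL0)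
    field_simp
    linear_combination A * this - B * hcA
  have hR' : R =O[𝓝 0] (fun _ => (1 : ℂ)) := hR.continuousAt.isBigO_one ℂ
  refine ((isBigO_refl (fun w : ℂ => w ^ 3) (𝓝 0)).mul hR').congr (fun w => ?_) fun w => mul_one _
  rw [hT w, hm₀']
  ring

namespace IsCritical

variable {S : Finset ℤ} {ρ τ : ℝ} {r : ℕ}

theorem V_rho (h : IsCritical S ρ τ) (hr : 1 ≤ r) : V S r ρ 1 = τ := by
  obtain ⟨y, hy0, hyτ, hy⟩ := h.V_ofReal hr h.rho_pos.le le_rfl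
  have hρ : ‖(ρ : ℂ)‖ ≤ ρ := by rw [Complex.norm_real, Real.norm_of_nonneg h.rho_pos.le]
  have hyc := h.V_ne_zero hr (by exact_mod_cast h.rho_pos.ne') hρ
  have hf := h.functional_equation_one hr hρ
  rw [hy] at hyc hf ⊢
  have hy0' : y ≠ 0 := by exact_mod_cast hyc
  have hf' : y = ρ * (1 + y * Polynomial.aeval y (upPoly S)) := by
    rw [aeval_upPoly] at hf ⊢
    exact_mod_cast hf
  have hypos : 0 < y := hy0.lt_of_ne' hy0'
  have hSy : stepGF S y = stepGF S τ := by
    have := h.rho_pos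
    rw [h.stepGF_tau, stepGF_eq h.isStepSet]
    field_simp
    linear_combination -hf'
  congr 1
  by_contra hne
  -- Rolle's theorem would give a second positive critical point.
  obtain ⟨c, hc, hc'⟩ := exists_deriv_eq_zero (hyτ.lt_of_ne hne)
    (fun u hu => (hasDerivAt_stepGF h.isStepSet
      (hypos.trans_le hu.1).ne').continuousAt.continuousWithinAt) hSy
  have := (existsUnique_deriv_stepGF_eq_zero h.isStepSet h.exists_up).unique
    ⟨hypos.trans hc.1, hc'⟩ ⟨h.tau_pos, h.deriv_stepGF_tau⟩
  exact hc.2.ne this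

theorem mul_stepGF_V (h : IsCritical S ρ τ) (hr : 1 ≤ r) {z : ℂ} (hz : ‖z‖ ≤ ρ)
    (hV : V S r z 1 ≠ 0) : z * stepGF S (V S r z 1) = 1 := by
  refine mul_right_cancel₀ hV ?_
  rw [stepGF_eq h.isStepSet]
  field_simp
  linear_combination -h.functional_equation_one hr hz

/-- Near `ρ`, the generating function is the branch with positive real part of the solution of
`1 - z / ρ = 1 - S(τ) / S(u) = q(u) ^ 2`. The branch is fixed by connectedness, since the two
sides have the same sign on the real axis. -/
theorem eventually_V_eq (h : IsCritical S ρ τ) (hr : 1 ≤ r) {k H : ℂ → ℂ}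
    (hk : AnalyticAt ℂ (fun u => k u ^ (1 / 2 : ℂ)) τ) (hre : 0 < ((k τ) ^ (1 / 2 : ℂ)).re)
    (hkS : ∀ᶠ u in 𝓝 (τ : ℂ), (τ - u) ^ 2 * k u = 1 - 1 / (ρ * stepGF S u))
    (hH : ∀ᶠ u in 𝓝 (τ : ℂ), H ((τ - u) * k u ^ (1 / 2 : ℂ)) = u) :
    ∀ᶠ z in 𝓝[Metric.ball 0 ρ] (ρ : ℂ), V S r z 1 = H ((1 - z / ρ) ^ (1 / 2 : ℂ)) := by
  have hρ := h.rho_pos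
  have hτ := h.tau_pos
  have hρn : ‖(ρ : ℂ)‖ = ρ := by rw [Complex.norm_real, Real.norm_of_nonneg hρ.le]
  have hρc : (ρ : ℂ) ≠ 0 := by exact_mod_cast hρ.ne'
  have hP : ∀ᶠ u in 𝓝 (τ : ℂ), (τ - u) ^ 2 * k u = 1 - 1 / (ρ * stepGF S u) ∧
      H ((τ - u) * k u ^ (1 / 2 : ℂ)) = u ∧ u ≠ 0 ∧ 0 < (k u ^ (1 / 2 : ℂ)).re ∧
      ContinuousAt (fun u => k u ^ (1 / 2 : ℂ)) u := by
    have hpos : ∀ᶠ u in 𝓝 (τ : ℂ), 0 < (k u ^ (1 / 2 : ℂ)).re :=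
      (Complex.continuous_re.continuousAt.comp hk.continuousAt).eventually_const_lt hre
    filter_upwards [hkS, hH, eventually_ne_nhds (by exact_mod_cast hτ.ne' : (τ : ℂ) ≠ 0), hpos,
      hk.eventually_analyticAt] with u h1 h2 h3 h4 h5
    exact ⟨h1, h2, h3, h4, h5.continuousAt⟩
  have hVc := h.continuousOn_V hr (ρ : ℂ) (by rw [mem_closedBall_zero_iff, hρn])
  have hVc' : Filter.Tendsto (fun z => V S r z 1) (𝓝[Metric.closedBall 0 ρ] (ρ : ℂ)) (𝓝 τ) := by
    have := hVc.tendsto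
    rwa [h.V_rho hr] at this
  obtain ⟨ε, hε, hεP⟩ := Metric.mem_nhdsWithin_iff.mp (hVc'.eventually hP)
  set C := Metric.ball (ρ : ℂ) ε ∩ Metric.ball 0 ρ with hC
  have hCP : ∀ z ∈ C, ‖z‖ < ρ ∧ _ := fun z hz =>
    ⟨mem_ball_zero_iff.mp hz.2, hεP ⟨hz.1, Metric.ball_subset_closedBall hz.2⟩⟩
  have hconn : IsPreconnected C := ((convex_ball _ _).inter (convex_ball _ _)).isPreconnected
  have hslit : ∀ z ∈ C, 0 < (1 - z / ρ).re := fun z hz => re_one_sub_div_pos hρn (hCP z hz).1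
  have hg : ContinuousOn (fun z : ℂ => (1 - z / ρ) ^ (1 / 2 : ℂ)) C := by
    intro z hz
    refine ContinuousAt.continuousWithinAt ?_
    refine ContinuousAt.cpow (by fun_prop) continuousAt_const (Or.inl (hslit z hz))
  have hf : ContinuousOn (fun z => (τ - V S r z 1) * k (V S r z 1) ^ (1 / 2 : ℂ)) C := by
    intro z hz
    have h1 : ContinuousWithinAt (fun z => V S r z 1) C z :=
      (h.continuousOn_V hr).mono (Set.inter_subset_right.trans Metric.ball_subset_closedBall) z hz
    have h2 := (hCP z hz).2.2.2.2.2
    exact (continuousWithinAt_const.sub h1).mul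
      (ContinuousAt.comp_continuousWithinAt (f := fun z => V S r z 1)
        (g := fun u => k u ^ (1 / 2 : ℂ)) h2 h1)
  have hsq : Set.EqOn ((fun z => (τ - V S r z 1) * k (V S r z 1) ^ (1 / 2 : ℂ)) ^ 2)
      ((fun z : ℂ => (1 - z / ρ) ^ (1 / 2 : ℂ)) ^ 2) C := by
    intro z hz
    obtain ⟨hzρ, h1, -, h3, -⟩ := hCP z hz
    simp only [Pi.pow_apply, mul_pow, cpow_half_sq]
    rw [h1]
    have h4 := h.mul_stepGF_V hr hzρ.le h3
    have h5 : stepGF S (V S r z 1) ≠ 0 := right_ne_zero_of_mul_eq_one h4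
    field_simp
    linear_combination h4
  have hg0 : ∀ {z : ℂ}, z ∈ C → (1 - z / ρ) ^ (1 / 2 : ℂ) ≠ 0 := by
    intro z hz h0
    have h1 := cpow_half_sq (1 - z / ρ)
    rw [h0] at h1
    have := hslit z hz
    rw [← h1] at this
    simp at this
  -- The two square roots agree at a real point, where `τ - V` is nonnegative.
  obtain ⟨x, hx0, hxρ, hxC⟩ : ∃ x : ℝ, 0 < x ∧ x < ρ ∧ (x : ℂ) ∈ C := by
    refine ⟨max (ρ - ε / 2) (ρ / 2), lt_max_of_lt_right (by positivity),
      max_lt (by linarith) (by linarith), ?_, ?_⟩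
    · rw [Metric.mem_ball, Complex.dist_eq, ← Complex.ofReal_sub, Complex.norm_real,
        Real.norm_eq_abs, abs_lt]
      constructor
      · linarith [le_max_left (ρ - ε / 2) (ρ / 2)]
      · linarith [max_lt (by linarith : ρ - ε / 2 < ρ + ε) (by linarith : ρ / 2 < ρ + ε)]
    · rw [mem_ball_zero_iff, Complex.norm_real, Real.norm_of_nonneg (by positivity)]
      exact max_lt (by linarith) (by linarith)
  have hpt : (τ - V S r x 1) * k (V S r x 1) ^ (1 / 2 : ℂ) = (1 - x / ρ) ^ (1 / 2 : ℂ) := by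
    obtain ⟨y, hy0, hyτ, hy⟩ := h.V_ofReal hr hx0.le hxρ.le
    refine (sq_eq_sq_iff_eq_or_eq_neg.mp (hsq hxC)).resolve_right fun hneg => ?_
    have h1 := (hCP _ hxC).2.2.2.2.1
    beta_reduce at hneg
    rw [hy] at hneg h1
    have hu : 0 ≤ 1 - x / ρ := by rw [sub_nonneg, div_le_one hρ]; exact hxρ.le
    have hsqrt : (1 - (x : ℂ) / ρ) ^ (1 / 2 : ℂ) = (√(1 - x / ρ) : ℝ) := by
      rw [← cpow_half_ofReal_sq (Real.sqrt_nonneg _), ← Complex.ofReal_pow, Real.sq_sqrt hu]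
      push_cast
      rfl
    have hne := hg0 hxC
    rw [hsqrt] at hne hneg
    have hspos : 0 < √(1 - x / ρ) :=
      (Real.sqrt_nonneg _).lt_of_ne' (by exact_mod_cast hne)
    have h2 := congrArg Complex.re hneg
    rw [← Complex.ofReal_sub, Complex.re_ofReal_mul, Complex.neg_re, Complex.ofReal_re] at h2
    nlinarith [mul_nonneg (sub_nonneg.mpr hyτ) h1.le]
  have heqOn := hconn.eq_of_sq_eq hf hg hsq hg0 hxC hpt
  refine Metric.mem_nhdsWithin_iff.mpr ⟨ε, hε, fun z hz => ?_⟩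
  have h1 := (hCP z hz).2.2.1
  have h2 := heqOn hz
  simp only at h2
  rw [h2] at h1
  exact h1.symm

/-- The local form of `V` at its dominant singularity `ρ`. -/
theorem exists_local_form (h : IsCritical S ρ τ) (hr : 1 ≤ r) :
    ∃ H : ℂ → ℂ, AnalyticAt ℂ H 0 ∧ deriv H 0 ≠ 0 ∧
      (fun w => H w - (τ - (√(2 * stepGF S τ / iteratedDeriv 2 (stepGF S) τ) : ℝ) * w -
        (stepGF S τ * iteratedDeriv 3 (stepGF S) τ /
          (3 * iteratedDeriv 2 (stepGF S) τ ^ 2) : ℝ) * w ^ 2)) =O[𝓝 0] (fun w => w ^ 3) ∧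
      ∀ᶠ z in 𝓝[Metric.ball 0 ρ] (ρ : ℂ), V S r z 1 = H ((1 - z / ρ) ^ (1 / 2 : ℂ)) := by
  have hρ := h.rho_pos
  have hτ := h.tau_pos
  have hρc : (ρ : ℂ) ≠ 0 := by exact_mod_cast hρ.ne'
  have hτc : (τ : ℂ) ≠ 0 := by exact_mod_cast hτ.ne'
  have hD2 := iteratedDeriv_two_stepGF_pos h.isStepSet hτ
  have c0 := iteratedDeriv_stepGF_ofReal S hτ.ne' 0
  have c1 := iteratedDeriv_stepGF_ofReal S hτ.ne' 1
  have c2 := iteratedDeriv_stepGF_ofReal S hτ.ne' 2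
  have c3 := iteratedDeriv_stepGF_ofReal S hτ.ne' 3
  rw [iteratedDeriv_zero, iteratedDeriv_zero, h.stepGF_tau] at c0
  rw [iteratedDeriv_one, iteratedDeriv_one, h.deriv_stepGF_tau, Complex.ofReal_zero] at c1
  have hSan := analyticAt_stepGF S hτc
  obtain ⟨n, hn, hn0, hT⟩ := exists_taylor_three hSan
  set D2 := iteratedDeriv 2 (stepGF S) τ
  set D3 := iteratedDeriv 3 (stepGF S) τ
  rw [c3] at hn0
  simp only [c1, c2, zero_mul, add_zero] at hT
  have hSne : stepGF S (τ : ℂ) ≠ 0 := by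
    rw [c0]; exact_mod_cast (one_div_pos.mpr hρ).ne'
  -- `1 - S(τ) / S(u) = (u - τ) ^ 2 * k u` with `k τ = σ ^ 2 > 0`, by Taylor expansion at `τ`.
  set k : ℂ → ℂ := fun u => ((D2 : ℂ) / 2 + (u - τ) * n u) / stepGF S u with hk
  set σ : ℝ := √(D2 / 2 * ρ) with hσ
  have hσpos : 0 < σ := Real.sqrt_pos.mpr (by positivity)
  have hσsq : σ ^ 2 = D2 / 2 * ρ := Real.sq_sqrt (by positivity)
  have hkτ : k τ = (σ : ℂ) ^ 2 := by
    rw [← Complex.ofReal_pow, hσsq]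
    simp only [hk, sub_self, zero_mul, add_zero, c0]
    push_cast
    field_simp
  have hkτ' : k τ ^ (1 / 2 : ℂ) = σ := by rw [hkτ, cpow_half_ofReal_sq hσpos.le]
  have hkan : AnalyticAt ℂ k τ := by
    refine AnalyticAt.div ?_ hSan hSne
    fun_prop
  have hka : AnalyticAt ℂ (fun u => k u ^ (1 / 2 : ℂ)) τ := by
    refine hkan.cpow analyticAt_const ?_
    rw [hkτ, ← Complex.ofReal_pow]
    exact Complex.ofReal_mem_slitPlane.mpr (by positivity)
  have hkS : ∀ᶠ u in 𝓝 (τ : ℂ), (τ - u) ^ 2 * k u = 1 - 1 / (ρ * stepGF S u) := by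
    filter_upwards [hSan.continuousAt.eventually_ne hSne] with u hu
    have h1 := hT u
    rw [c0] at h1
    push_cast at h1
    simp only [hk]
    field_simp
    field_simp at h1
    linear_combination -h1
  set q : ℂ → ℂ := fun u => (τ - u) * k u ^ (1 / 2 : ℂ) with hq
  have hqan : AnalyticAt ℂ q τ := (analyticAt_const.sub analyticAt_id).mul hka
  have hqτ : q τ = 0 := by simp [hq]
  have hqd : deriv q τ = -σ := by
    have h1 := ((hasDerivAt_id' (τ : ℂ)).const_sub (τ : ℂ)).mul hka.differentiableAt.hasDerivAt
    refine h1.deriv.trans ?_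
    simp only [hkτ', sub_self]
    ring
  have hσc : (σ : ℂ) ≠ 0 := by exact_mod_cast hσpos.ne'
  obtain ⟨H, hHan, hH0, hHd, hHl, hHr⟩ := exists_local_inverse hqan
    (by rw [hqd]; exact neg_ne_zero.mpr hσc)
  rw [hqτ] at hHan hH0 hHd hHr
  rw [hqd] at hHd
  have hHne : deriv H 0 ≠ 0 := by rw [hHd]; exact inv_ne_zero (neg_ne_zero.mpr hσc)
  refine ⟨H, hHan, hHne, ?_, h.eventually_V_eq hr hka ?_ hkS hHl⟩
  · have hHτ : Filter.Tendsto H (𝓝 0) (𝓝 τ) := by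
      have := hHan.continuousAt.tendsto
      rwa [hH0] at this
    have heq : ∀ᶠ w in 𝓝 0, stepGF S (H w) * (1 - w ^ 2) = stepGF S (τ : ℂ) := by
      filter_upwards [hHr, hHτ.eventually hkS,
        hHτ.eventually (hSan.continuousAt.eventually_ne hSne)] with w h1 h2 h3
      have h4 : w ^ 2 = (τ - H w) ^ 2 * k (H w) := by
        conv_lhs => rw [← h1]
        simp only [hq, mul_pow, cpow_half_sq]
      rw [h4, h2, c0]
      push_cast
      field_simp
      ring
    have hσ2 : (σ : ℂ) ^ 2 = D2 / 2 * ρ := by exact_mod_cast hσsq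
    have hD2c : (D2 : ℂ) ≠ 0 := by exact_mod_cast hD2.ne'
    have key := isBigO_of_local_equation (A := (D2 : ℂ) / 2) (div_ne_zero hD2c two_ne_zero)
      (c := deriv H 0) hHne (by
        rw [hHd, c0, inv_pow, neg_sq, hσ2]
        push_cast
        field_simp) hn hn0 hT hHan hH0 rfl heq
    have hsqrt : √(2 * stepGF S τ / D2) = σ⁻¹ := by
      rw [hσ, ← Real.sqrt_inv, h.stepGF_tau]
      congr 1
      field_simp
    refine key.congr_left fun w => ?_
    rw [hsqrt, hHd, c0, h.stepGF_tau]
    push_cast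
    field_simp
    ring
  · rw [hkτ', Complex.ofReal_re]
    exact hσpos

end IsCritical

/-! ### All points of the circle of convergence -/

namespace IsCritical

variable {S : Finset ℤ} {ρ τ : ℝ} {r : ℕ}

/-- The local form at `ζ ρ` is `ζ` times the one at `ρ`, since `V(ζ z) = ζ V(z)`. -/
theorem eventually_V_eq_rotate (h : IsCritical S ρ τ) (hr : 1 ≤ r) {H : ℂ → ℂ}
    (hH : ∀ᶠ z in 𝓝[Metric.ball 0 ρ] (ρ : ℂ), V S r z 1 = H ((1 - z / ρ) ^ (1 / 2 : ℂ)))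
    {ζ : ℂ} (hζ1 : ‖ζ‖ = 1) (hζ : ∀ d ∈ upSteps S, ζ ^ (d + 1) = 1) :
    ∀ᶠ z in 𝓝[Metric.ball 0 ρ] (ζ * ρ),
      V S r z 1 = ζ * H ((1 - z / (ζ * ρ)) ^ (1 / 2 : ℂ)) := by
  have hζ0 : ζ ≠ 0 := norm_pos_iff.mp (hζ1 ▸ one_pos)
  have hball : ∀ z : ℂ, z ∈ Metric.ball 0 ρ → ζ⁻¹ * z ∈ Metric.ball 0 ρ := by
    intro z hz
    rw [mem_ball_zero_iff] at hz ⊢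
    rwa [norm_mul, norm_inv, hζ1, inv_one, one_mul]
  have ht : Filter.Tendsto (fun z => ζ⁻¹ * z) (𝓝[Metric.ball 0 ρ] (ζ * ρ))
      (𝓝[Metric.ball 0 ρ] (ρ : ℂ)) := by
    refine tendsto_nhdsWithin_iff.mpr ⟨?_, ?_⟩
    · exact ((continuous_const_mul ζ⁻¹).tendsto' _ _
        (inv_mul_cancel_left₀ hζ0 _)).mono_left nhdsWithin_le_nhds
    · filter_upwards [self_mem_nhdsWithin] with z hz using hball z hz
  filter_upwards [ht.eventually hH, self_mem_nhdsWithin] with z hz hzb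
  have hle := (mem_ball_zero_iff.mp (hball z hzb)).le
  have hrot := h.V_mul_rootOfUnity hr hle hζ1 hζ
  rw [mul_inv_cancel_left₀ hζ0] at hrot
  rw [hrot, hz]
  congr 4
  rw [inv_mul_eq_div, div_div]

/-- Where the derivative of `1 / S` does not vanish, its local inverse continues `V`. -/
theorem not_isSingularity (h : IsCritical S ρ τ) (hr : 1 ≤ r) {w : ℂ} (hw : ‖w‖ = ρ)
    (hd : deriv (stepGF S) (V S r w 1) ≠ 0) :
    ¬ IsSingularity (fun z => V S r z 1) ρ w := by
  have hw0 : w ≠ 0 := norm_pos_iff.mp (hw ▸ h.rho_pos)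
  have hV := h.V_ne_zero hr hw0 hw.le
  have hwS := h.mul_stepGF_V hr hw.le hV
  have hS0 : stepGF S (V S r w 1) ≠ 0 := right_ne_zero_of_mul_eq_one hwS
  have hSan := analyticAt_stepGF S hV
  have hψd : deriv (fun u => (stepGF S u)⁻¹) (V S r w 1) ≠ 0 := by
    have := hSan.differentiableAt.hasDerivAt.inv hS0
    refine (this.deriv).trans_ne ?_
    exact div_ne_zero (neg_ne_zero.mpr hd) (pow_ne_zero 2 hS0)
  obtain ⟨g, hg, -, -, hgl, -⟩ := exists_local_inverse (hSan.fun_inv hS0) hψd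
  have hψ : ∀ {z : ℂ}, ‖z‖ ≤ ρ → V S r z 1 ≠ 0 → (stepGF S (V S r z 1))⁻¹ = z := fun hz h0 =>
    inv_eq_of_mul_eq_one_left (h.mul_stepGF_V hr hz h0)
  rw [hψ hw.le hV] at hg
  refine not_not.mpr ⟨g, hg, ?_⟩
  have hc : Filter.Tendsto (fun z => V S r z 1) (𝓝[Metric.ball 0 ρ] w) (𝓝 (V S r w 1)) :=
    (h.continuousOn_V hr w (by rw [mem_closedBall_zero_iff, hw])).tendsto.mono_left
      (nhdsWithin_mono _ Metric.ball_subset_closedBall)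
  filter_upwards [hc.eventually hgl, hc.eventually_ne hV, self_mem_nhdsWithin] with z h1 h2 hz
  rwa [hψ (mem_ball_zero_iff.mp hz).le h2] at h1

theorem le_radius (h : IsCritical S ρ τ) (hr : 1 ≤ r) :
    ENNReal.ofReal ρ ≤
      (FormalMultilinearSeries.ofScalars ℂ (fun n => treeCoeff S r n 1)).radius := by
  have hρ : ‖(ρ : ℂ)‖ = ρ := by rw [Complex.norm_real, Real.norm_of_nonneg h.rho_pos.le]
  refine FormalMultilinearSeries.le_radius_of_summable _ (r := ρ.toNNReal) ?_
  have := (h.hasSum_treeCoeff hr (t := 1) hρ.le (by rw [norm_one, mul_one, hρ])).summable.norm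
  simpa only [FormalMultilinearSeries.ofScalars_norm, norm_mul, norm_pow, hρ,
    Real.coe_toNNReal _ h.rho_pos.le] using this

theorem radius_le (h : IsCritical S ρ τ)
    (hs : IsSingularity (fun z => V S r z 1) ρ ρ) :
    (FormalMultilinearSeries.ofScalars ℂ (fun n => treeCoeff S r n 1)).radius ≤
      ENNReal.ofReal ρ := by
  by_contra hlt
  rw [not_le] at hlt
  set P := FormalMultilinearSeries.ofScalars ℂ (fun n => treeCoeff S r n 1) with hP
  refine hs ⟨P.sum, ?_, Filter.Eventually.of_forall fun z => ?_⟩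
  · refine (P.hasFPowerSeriesOnBall (bot_lt_of_lt hlt)).analyticAt_of_mem ?_
    rw [Metric.mem_eball, edist_zero_right, ← ofReal_norm, Complex.norm_real,
      Real.norm_of_nonneg h.rho_pos.le]
    exact hlt
  · simp [hP, FormalMultilinearSeries.sum, V, mul_comm]

end IsCritical

end Lukasiewicz

end

theorem mainTheorem7 (S : Finset ℤ) (hS : Lukasiewicz.IsStepSet S) (hup : ∃ s ∈ S, 1 ≤ s)
    (p : ℕ) (hp : Lukasiewicz.IsPeriod S p) (r : ℕ) (hr : 1 ≤ r) :
    (∃! τ : ℝ, 0 < τ ∧ deriv (Lukasiewicz.stepGF S) τ = 0) ∧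
    ∀ τ : ℝ, 0 < τ → deriv (Lukasiewicz.stepGF S) τ = 0 →
    ∀ ρ : ℝ, ρ = 1 / Lukasiewicz.stepGF S τ →
      -- radius of convergence of `V(z) = V(z, 1)`
      (FormalMultilinearSeries.ofScalars ℂ
        (fun n => Lukasiewicz.treeCoeff S r n 1)).radius = ENNReal.ofReal ρ ∧
      -- location of the dominant singularities
      {w : ℂ | ‖w‖ = ρ ∧ Lukasiewicz.IsSingularity (fun z => Lukasiewicz.V S r z 1) ρ w} =
        {w : ℂ | ∃ ζ : ℂ, ζ ^ p = 1 ∧ w = ζ * ρ} ∧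
      -- their type and the singular expansions
      (∀ ζ : ℂ, ζ ^ p = 1 →
        Lukasiewicz.IsSqrtSingularity (fun z => Lukasiewicz.V S r z 1) ρ (ζ * ρ) ∧
        Lukasiewicz.HasSingularExpansion (fun z => Lukasiewicz.V S r z 1) ρ (ζ * ρ)
          (fun z => ζ * τ
            - ζ * (√(2 * Lukasiewicz.stepGF S τ
                / iteratedDeriv 2 (Lukasiewicz.stepGF S) τ) : ℝ)
              * (1 - z / (ζ * ρ)) ^ (1 / 2 : ℂ)
            - ζ * (Lukasiewicz.stepGF S τ * iteratedDeriv 3 (Lukasiewicz.stepGF S) τ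
                / (3 * iteratedDeriv 2 (Lukasiewicz.stepGF S) τ ^ 2) : ℝ)
              * (1 - z / (ζ * ρ)))
          (fun z => (1 - z / (ζ * ρ)) ^ (3 / 2 : ℂ))) ∧
      -- `V(z, t)` is given by a convergent series and analytic in `t` near `t = 1`
      (∀ z : ℂ, ‖z‖ < ρ →
        (∀ᶠ t in nhds (1 : ℂ), Summable fun n => Lukasiewicz.treeCoeff S r n t * z ^ n) ∧
        AnalyticAt ℂ (fun t => Lukasiewicz.V S r z t) 1) ∧
      -- every `t`-derivative at `t = 1` is a rational expression in `z` and `V(z)`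
      (∀ ν : ℕ, ∃ P Q : MvPolynomial (Fin 2) ℤ, ∀ z : ℂ, ‖z‖ < ρ →
        MvPolynomial.aeval ![z, Lukasiewicz.V S r z 1] Q ≠ 0 ∧
        iteratedDeriv ν (fun t => Lukasiewicz.V S r z t) 1 =
          MvPolynomial.aeval ![z, Lukasiewicz.V S r z 1] P /
            MvPolynomial.aeval ![z, Lukasiewicz.V S r z 1] Q) ∧
      -- the first `t`-derivative
      (∀ z : ℂ, z ≠ 0 → ‖z‖ < ρ →
        Lukasiewicz.V S r z 1 ≠ 0 ∧
        deriv (Lukasiewicz.stepGF S) (Lukasiewicz.V S r z 1) ≠ 0 ∧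
        HasDerivAt (fun t => Lukasiewicz.V S r z t)
          (-z * ((Lukasiewicz.V S r z 1 - z) ^ r /
            (Lukasiewicz.V S r z 1 ^ (r + 2) *
              deriv (Lukasiewicz.stepGF S) (Lukasiewicz.V S r z 1)))) 1) := by
  have hup' := Lukasiewicz.exists_mem_upSteps hup
  refine ⟨Lukasiewicz.existsUnique_deriv_stepGF_eq_zero hS hup', ?_⟩
  rintro τ hτ hd ρ rfl
  have h := Lukasiewicz.isCritical_of_deriv_eq_zero hS hup' hτ hd
  set ρ := 1 / Lukasiewicz.stepGF S τ
  have hρ := h.rho_pos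
  obtain ⟨H, hHan, hHne, hHO, hHV⟩ := h.exists_local_form hr
  have hp0 := hp.pos hS
  have hunit : ∀ ζ : ℂ, ζ ^ p = 1 → ‖ζ‖ = 1 := fun ζ hζ =>
    Complex.norm_eq_one_of_pow_eq_one hζ hp0.ne'
  have hnorm : ∀ ζ : ℂ, ζ ^ p = 1 → ‖ζ * ρ‖ = ρ := fun ζ hζ => by
    rw [norm_mul, hunit ζ hζ, one_mul, Complex.norm_real, Real.norm_of_nonneg hρ.le]
  have hpow : ∀ ζ : ℂ, ζ ^ p = 1 → ∀ d ∈ Lukasiewicz.upSteps S, ζ ^ (d + 1) = 1 := by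
    intro ζ hζ d hd
    obtain ⟨m, hm⟩ := hp.dvd hS hd
    rw [hm, pow_mul, hζ, one_pow]
  have hrot := fun (ζ : ℂ) (hζ : ζ ^ p = 1) =>
    h.eventually_V_eq_rotate hr hHV (hunit ζ hζ) (hpow ζ hζ)
  have hsqrt : ∀ ζ : ℂ, ζ ^ p = 1 →
      Lukasiewicz.IsSqrtSingularity (fun z => Lukasiewicz.V S r z 1) ρ (ζ * ρ) := by
    intro ζ hζ
    refine ⟨fun w => ζ * H w, analyticAt_const.mul hHan, ?_, hrot ζ hζ⟩
    rw [deriv_const_mul _ hHan.differentiableAt]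
    exact mul_ne_zero (norm_pos_iff.mp (hunit ζ hζ ▸ one_pos)) hHne
  have hsing : ∀ ζ : ℂ, ζ ^ p = 1 →
      Lukasiewicz.IsSingularity (fun z => Lukasiewicz.V S r z 1) ρ (ζ * ρ) := fun ζ hζ =>
    (hsqrt ζ hζ).isSingularity hρ (hnorm ζ hζ)
  refine ⟨(h.radius_le ?_).antisymm (h.le_radius hr), ?_, fun ζ hζ => ⟨hsqrt ζ hζ, ?_⟩,
    fun z hz => ⟨?_, h.analyticAt_V hr hz⟩, h.exists_rational hr,
    fun z hz0 hz => ⟨h.V_ne_zero hr hz0 hz.le, h.deriv_stepGF_V_ne_zero hr hz0 hz,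
      h.hasDerivAt_V hr hz0 hz⟩⟩
  · simpa using hsing 1 (one_pow p)
  · ext w
    constructor
    · rintro ⟨hw, hws⟩
      have hw0 : w ≠ 0 := norm_pos_iff.mp (hw ▸ hρ)
      obtain ⟨ω, hω, rfl⟩ := h.exists_eq_mul_of_deriv_eq_zero (h.V_ne_zero hr hw0 hw.le)
        (h.norm_V_le hr hw.le) hw (h.functional_equation_one hr hw.le)
        (by_contra fun hne => h.not_isSingularity hr hw hne hws)
      obtain ⟨d, hd, -⟩ := hup'
      exact ⟨ω, hp.pow_eq_one hS hd hω, rfl⟩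
    · rintro ⟨ζ, hζ, rfl⟩
      exact ⟨hnorm ζ hζ, hsing ζ hζ⟩
  · have hO := hHO.const_mul_left ζ
    have key := Lukasiewicz.hasSingularExpansion_of_sqrt hρ (hnorm ζ hζ)
      (analyticAt_const.mul hHan) (hrot ζ hζ) (hO.congr_left fun w => mul_sub _ _ _)
    refine Eq.mp ?_ key
    congr 1
    funext z
    rw [Lukasiewicz.cpow_half_sq]
    ring
  · filter_upwards [Lukasiewicz.IsMajorant.eventually_mul_norm_lt hz] with t ht
    exact (h.hasSum_treeCoeff hr hz.le ht.le).summable
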